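/- Identify $\mathbb{R}^2$ with $\mathbb{C}$, let $|\cdot|$ be the Euclidean norm, $\mathbb{B}_R(0)$ the open ball of radius $R$ about $0$, $\mathrm{d}(A,B)=\inf_{x\in A,\,y\in B}|x-y|$ (with value $\infty$ if $A$ or $B$ is empty), and let $C$ in the exponent denote the complement in $\mathbb{R}^2$. Setting. Let $\Omega\subset\mathbb{R}^2$ be open and let $(\Omega_n)_{n\in\mathbb{N}}$ be non-empty open sets with $\Omega_n\neq\mathbb{R}^2$, $\Omega_n\subset\Omega_{n+1}$, $\Omega=\bigcup_n\Omega_n$ and $\mathrm{d}(\Omega_n,\partial\Omega_k)>0$ for all $k>n$. Let $\nu_n\colon\Omega\to(0,\infty)$ be continuous with $\nu_n\le\nu_{n+1}$ for all $n$. For $f\in C^\infty(\Omega_n,\mathbb{C})$ and $m\in\mathbb{N}_0$ put $$|f|_{n,m}=\sup_{x\in\Omega_n,\;\beta\in\mathbb{N}_0^2,\;|\beta|\le m}|\partial^\beta f(x)|\,\nu_n(x),$$ and let $\mathcal{E}\nu_n(\Omega_n)=\{f\in C^\infty(\Omega_n,\mathbb{C}) : |f|_{n,m}<\infty\ \forall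 m\in\mathbb{N}_0\}$ and $\mathcal{E}\nu_{n,\overline\partial}(\Omega_n)=\{f\in\mathcal{E}\nu_n(\Omega_n) : \overline\partial f=0\}$, where $\overline\partial=\frac12(\partial_1+i\partial_2)$. For $k\ge n$ let $\pi_{k,n}(f)=f|_{\Omega_n}$. Condition. Suppose that for every $n\in\mathbb{N}$ there are an entire function $g_n$ with $g_n(0)=1$ and indices $I_1(n),I_2(n),I_4(n)>n$ such that, with $I_{14}(n)=I_1(I_4(n))$ and $I_{214}(n)=I_2(I_{14}(n))$, the following hold for every $n\in\mathbb{N}$. a) (i) For every $\varepsilon>0$ there is a compact set $K\subset\overline{\Omega}_n$ with $\nu_n(x)\le\varepsilon\,\nu_{I_1(n)}(x)$ for all $x\in\Omega_n\setminus K$. (ii) There are an open set $X_{I_2(n)}\subset\mathbb{R}^2\setminus\overline{\Omega}_{I_2(n)}$, real numbers $R_n,r_n$ with $0<2R_n<\mathrm{d}_n:=\mathrm{d}(X_{I_2(n)},\Omega_{I_2(n)})$ and $R_n<r_n<\mathrm{d}_n-R_n$, and a function $A_2(\cdot,n)\colon X_{I_2(n)}+\mathbb{B}_{R_n}(0)\to(0,\infty)$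 whose restriction to $X_{I_2(n)}$ is locally bounded, such that $|g_n(\zeta)|\,\nu_{I_2(n)}(z)\le A_2(x,n)$ for all $z\in\Omega_{I_2(n)}$, $x\in X_{I_2(n)}+\mathbb{B}_{R_n}(0)$ and $\zeta\in\mathbb{C}$ with $|\zeta-(z-x)|=r_n$. (iii) For every compact $K\subset\mathbb{R}^2$ there is $A_3(n,K)>0$ with $\int_K\frac{|g_n(x-y)|\nu_n(x)}{|x-y|}\,dy\le A_3(n,K)$ for all $x\in\Omega_n$. b) There is $A_4(n)>0$ such that for $(k,p)=(I_4(n),n)$ and for $(k,p)=(I_{14}(n),I_{14}(n))$ $$\int_{\Omega_{I_4(n)}}\frac{|g_{I_{14}(n)}(x-y)|\,\nu_p(x)}{|x-y|\,\nu_k(y)}\,dy\le A_4(n),\qquad x\in\Omega_p.$$ c) For every closed set $M\subset\overline{\Omega}_n$ and every connected component $N$ of $M^C$: if $N\cap\overline{\Omega}_n^{\,C}\neq\varnothing$, then $N\cap X_{I_{214}(n)}\neq\varnothing$ (where $X_{I_{214}(n)}$ is the set of a)(ii) for the index $I_{14}(n)$). Theorem. Under this condition, for every $n\in\mathbb{N}$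 the space $\pi_{I_{214}(n),n}\bigl(\mathcal{E}\nu_{I_{214}(n),\overline\partial}(\Omega_{I_{214}(n)})\bigr)$ is a dense subspace of $\pi_{I_{14}(n),n}\bigl(\mathcal{E}\nu_{I_{14}(n),\overline\partial}(\Omega_{I_{14}(n)})\bigr)$ with respect to the seminorms $(|\cdot|_{n,m})_{m\in\mathbb{N}_0}$. -/

import Mathlib

open Set Topology
open scoped ENNReal ContDiff Pointwise

noncomputable section

namespace WeightedCR

/-- The distance `inf {|x - y| : x ∈ A, y ∈ B}` of two subsets of the plane, with values in
`[0, ∞]`; it is `∞` if one of the sets is empty. -/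
def setDist (A B : Set ℂ) : ℝ≥0∞ := ⨅ x ∈ A, ⨅ y ∈ B, edist x y

/-- The first real partial derivative of a function on `ℂ = ℝ²`. -/
def pd₁ (f : ℂ → ℂ) : ℂ → ℂ := fun z => fderiv ℝ f z 1

/-- The second real partial derivative of a function on `ℂ = ℝ²`. -/
def pd₂ (f : ℂ → ℂ) : ℂ → ℂ := fun z => fderiv ℝ f z Complex.I

/-- The iterated real partial derivative `∂^β f` for a multi-index `β = (β₁, β₂)`. -/
def pd (β : ℕ × ℕ) (f : ℂ → ℂ) : ℂ → ℂ := pd₁^[β.1] (pd₂^[β.2] f)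

/-- The Cauchy-Riemann operator `½ (∂₁ + i ∂₂)`. -/
def dbar (f : ℂ → ℂ) : ℂ → ℂ := fun z => (1 / 2 : ℂ) * (pd₁ f z + Complex.I * pd₂ f z)

/-- Extension by zero to `ℂ` of a function defined on a subset `U`. On an open set `U` it has the
same local behaviour as the function, so derivatives at points of `U` may be computed from it. -/
def zeroExt {U : Set ℂ} (f : U → ℂ) : ℂ → ℂ := Function.extend Subtype.val f 0

/-- An exhaustion of an open set `Ω` of the plane by non-empty open sets `Ω₀ ⊆ Ω₁ ⊆ …`
together with a directed family of continuous weights `ν₀ ≤ ν₁ ≤ …` on `Ω`.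
Only the values of the weights on `Ω` matter. -/
structure WeightSystem where
  /-- the open set `Ω` -/
  Om : Set ℂ
  /-- the sets `Ω_n` -/
  dom : ℕ → Set ℂ
  /-- the weights `ν_n` -/
  ν : ℕ → ℂ → ℝ
  isOpen_Om : IsOpen Om
  isOpen_dom : ∀ n, IsOpen (dom n)
  nonempty_dom : ∀ n, (dom n).Nonempty
  dom_subset_succ : ∀ n, dom n ⊆ dom (n + 1)
  iUnion_dom : Om = ⋃ n, dom n
  continuousOn_ν : ∀ n, ContinuousOn (ν n) Om
  ν_pos : ∀ n, ∀ x ∈ Om, 0 < ν n x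
  ν_le_succ : ∀ n, ∀ x ∈ Om, ν n x ≤ ν (n + 1) x

namespace WeightSystem

variable (S : WeightSystem)

theorem dom_mono {n k : ℕ} (h : n ≤ k) : S.dom n ⊆ S.dom k :=
  monotone_nat_of_le_succ (f := S.dom) S.dom_subset_succ h

/-- `|f|_{n,m}`, the supremum of `|∂^β f(x)| ν_n(x)` over `x ∈ Ω_n` and `|β| ≤ m`, in `[0, ∞]`. -/
def seminorm (n m : ℕ) (f : S.dom n → ℂ) : ℝ≥0∞ :=
  ⨆ (x : S.dom n) (β : ℕ × ℕ) (_ : β.1 + β.2 ≤ m),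
    ENNReal.ofReal (‖pd β (zeroExt f) x‖ * S.ν n x)

/-- The space `ℰν_n(Ω_n)` of weighted smooth functions. -/
def space (n : ℕ) : Set (S.dom n → ℂ) :=
  {f | ContDiffOn ℝ ∞ (zeroExt f) (S.dom n) ∧ ∀ m : ℕ, S.seminorm n m f < ⊤}

/-- The subspace of `ℰν_n(Ω_n)` of functions in the kernel of the Cauchy-Riemann operator. -/
def dbarSpace (n : ℕ) : Set (S.dom n → ℂ) :=
  {f | f ∈ S.space n ∧ ∀ x : S.dom n, dbar (zeroExt f) x = 0}

/-- The restriction map `π_{k,n} : f ↦ f|_{Ω_n}` for `k ≥ n`. -/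
def res {k n : ℕ} (h : n ≤ k) (f : S.dom k → ℂ) : S.dom n → ℂ :=
  fun x => f ⟨x, S.dom_mono h x.2⟩

end WeightSystem

/-- `F` is a dense subset of `G` with respect to the family `(p m)`: `F ⊆ G`, and every basic
neighbourhood of a point of `G`, given by finitely many of the `p m`, meets `F`. -/
def IsDenseIn {V : Type*} [AddCommGroup V] (p : ℕ → V → ℝ≥0∞) (F G : Set V) : Prop :=
  F ⊆ G ∧ ∀ f ∈ G, ∀ s : Finset ℕ, ∀ ε : ℝ, 0 < ε →
    ∃ h ∈ F, ∀ m ∈ s, p m (f - h) < ENNReal.ofReal ε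

/-- The density condition. The data are the index functions `I₁, I₂, I₄`, the entire
functions `g_n` and the open sets `X n`, which stand for `X_{I₂(n)}`. -/
structure DenseCondition (S : WeightSystem) where
  /-- the index function `I₁` -/
  I₁ : ℕ → ℕ
  /-- the index function `I₂` -/
  I₂ : ℕ → ℕ
  /-- the index function `I₄` -/
  I₄ : ℕ → ℕ
  /-- the entire functions `g_n` -/
  g : ℕ → ℂ → ℂ
  /-- the open sets `X_{I₂(n)}` -/
  X : ℕ → Set ℂ
  dom_ne_univ : ∀ n, S.dom n ≠ univ
  setDist_pos : ∀ n k, n < k → 0 < setDist (S.dom n) (frontier (S.dom k))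
  lt_I₁ : ∀ n, n < I₁ n
  lt_I₂ : ∀ n, n < I₂ n
  lt_I₄ : ∀ n, n < I₄ n
  entire_g : ∀ n, Differentiable ℂ (g n)
  g_zero : ∀ n, g n 0 = 1
  /-- a)(i) -/
  small_off_compact : ∀ n, ∀ ε : ℝ, 0 < ε → ∃ K : Set ℂ, IsCompact K ∧ K ⊆ closure (S.dom n) ∧
    ∀ x ∈ S.dom n \ K, S.ν n x ≤ ε * S.ν (I₁ n) x
  /-- a)(ii) -/
  isOpen_X : ∀ n, IsOpen (X n)
  X_subset : ∀ n, X n ⊆ (closure (S.dom (I₂ n)))ᶜ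
  cauchy_bound : ∀ n, ∃ (R r : ℝ) (A₂ : ℂ → ℝ),
    0 < R ∧
    ENNReal.ofReal (2 * R) < setDist (X n) (S.dom (I₂ n)) ∧
    R < r ∧
    ENNReal.ofReal (r + R) < setDist (X n) (S.dom (I₂ n)) ∧
    (∀ x ∈ X n + Metric.ball (0 : ℂ) R, 0 < A₂ x) ∧
    (∀ x ∈ X n, ∃ U ∈ 𝓝 x, BddAbove (A₂ '' (U ∩ X n))) ∧
    ∀ z ∈ S.dom (I₂ n), ∀ x ∈ X n + Metric.ball (0 : ℂ) R, ∀ ζ : ℂ, ‖ζ - (z - x)‖ = r →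
      ‖g n ζ‖ * S.ν (I₂ n) z ≤ A₂ x
  /-- a)(iii) -/
  integral_compact : ∀ n, ∀ K : Set ℂ, IsCompact K → ∃ A₃ : ℝ, 0 < A₃ ∧
    ∀ x ∈ S.dom n,
      ∫⁻ y in K, ENNReal.ofReal (‖g n (x - y)‖ * S.ν n x / ‖x - y‖) ≤ ENNReal.ofReal A₃
  /-- b) -/
  integral_dom : ∀ n, ∃ A₄ : ℝ, 0 < A₄ ∧
    ∀ kp ∈ ({(I₄ n, n), (I₁ (I₄ n), I₁ (I₄ n))} : Set (ℕ × ℕ)),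
      ∀ x ∈ S.dom kp.2,
        ∫⁻ y in S.dom (I₄ n),
          ENNReal.ofReal (‖g (I₁ (I₄ n)) (x - y)‖ * S.ν kp.2 x / (‖x - y‖ * S.ν kp.1 y))
            ≤ ENNReal.ofReal A₄
  /-- c) The component of `Mᶜ` containing `x` is `connectedComponentIn Mᶜ x`. -/
  component_meets : ∀ n, ∀ M : Set ℂ, IsClosed M → M ⊆ closure (S.dom n) → ∀ x ∈ Mᶜ,
    (connectedComponentIn Mᶜ x ∩ (closure (S.dom n))ᶜ).Nonempty →
      (connectedComponentIn Mᶜ x ∩ X (I₁ (I₄ n))).Nonempty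

namespace DenseCondition

variable {S : WeightSystem} (C : DenseCondition S)

/-- `I₁₄(n) = I₁(I₄(n))` -/
def I₁₄ (n : ℕ) : ℕ := C.I₁ (C.I₄ n)

/-- `I₂₁₄(n) = I₂(I₁₄(n))` -/
def I₂₁₄ (n : ℕ) : ℕ := C.I₂ (C.I₁₄ n)

theorem le_I₁₄ (n : ℕ) : n ≤ C.I₁₄ n := ((C.lt_I₄ n).trans (C.lt_I₁ _)).le

theorem le_I₂₁₄ (n : ℕ) : n ≤ C.I₂₁₄ n := (C.le_I₁₄ n).trans (C.lt_I₂ _).le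

end DenseCondition

end WeightedCR

end

namespace WeightedCR

open MeasureTheory Filter

/-! ### Partial derivatives -/

/-! The argument is Runge's pole pushing with weights. Put `q = I₄(n)`, `N = I₁₄(n)`, and let `E(z)
= g_N(z)/(πz)`, a fundamental solution of the Cauchy-Riemann operator because `g_N(0) = 1`
(`cauchyKernel_conv_dbar`).

Given `F` holomorphic on `Ω_N`, take a cut-off `ψ` that is `1` near the closure of `Ω_n` and
supported in `Ω_q`, and a compactly supported `χ` that is `1` on a large ball. Then `χψF = E * φ₁ +
E * φ₂` with `φ₁ = χ ∂̄(ψF)` and `φ₂ = ∂̄χ ψF`. On `Ω_n` this says `F - E * φ₁ = (1 - χ)F + E * φ₂`.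
Both terms on the right come from outside the ball, where a)(i) makes `ν_q` small against `ν_N`; the
integral estimate b) transfers the smallness of `φ₂` to `E * φ₂` (`exists_approx_by_conv_kernel`).

It remains to approximate `E * φ₁`, where `φ₁` is supported off the closure of `Ω_n`. Its weighted
derivatives up to order `m` form a vector in `ℓ^∞`, namely an integral over `w` of the jets of `E(·
- w)`. These jets depend holomorphically on `w` off the closure of `Ω_n`. For `w` in the set `X` of
a)(ii) they come from elements of the space on `Ω_{I₂₁₄(n)}`. By c) every component of the
complement meets `X`, so the identity theorem in the quotient by the closed span puts every jet in
the closure (`kernelJet_mem_closure`). The integral is then in the closure too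
(`exists_approx_conv_kernel`). -/

theorem _root_.Set.EqOn.pd₁ {U : Set ℂ} (hU : IsOpen U) {f g : ℂ → ℂ} (h : EqOn f g U) :
    EqOn (pd₁ f) (pd₁ g) U := fun z hz => by
  simp only [WeightedCR.pd₁, (h.eventuallyEq_of_mem (hU.mem_nhds hz)).fderiv_eq]

theorem _root_.Set.EqOn.pd₂ {U : Set ℂ} (hU : IsOpen U) {f g : ℂ → ℂ} (h : EqOn f g U) :
    EqOn (pd₂ f) (pd₂ g) U := fun z hz => by
  simp only [WeightedCR.pd₂, (h.eventuallyEq_of_mem (hU.mem_nhds hz)).fderiv_eq]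

theorem _root_.Set.EqOn.pd₁_iterate {U : Set ℂ} (hU : IsOpen U) {f g : ℂ → ℂ} (h : EqOn f g U)
    (k : ℕ) : EqOn (WeightedCR.pd₁^[k] f) (WeightedCR.pd₁^[k] g) U := by
  induction k with
  | zero => exact h
  | succ k ih =>
    rw [Function.iterate_succ_apply', Function.iterate_succ_apply']
    exact ih.pd₁ hU

theorem dbar_congr {U : Set ℂ} (hU : IsOpen U) {f g : ℂ → ℂ} (h : EqOn f g U) :
    EqOn (dbar f) (dbar g) U := fun z hz => by
  simp only [dbar, h.pd₁ hU hz, h.pd₂ hU hz]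

theorem _root_.ContDiffOn.pd₁ {U : Set ℂ} (hU : IsOpen U) {f : ℂ → ℂ} (hf : ContDiffOn ℝ ∞ f U) :
    ContDiffOn ℝ ∞ (pd₁ f) U :=
  (hf.fderiv_of_isOpen hU (m := ∞) (by simp)).clm_apply contDiffOn_const

theorem _root_.ContDiff.pd₁ {f : ℂ → ℂ} (hf : ContDiff ℝ ∞ f) : ContDiff ℝ ∞ (pd₁ f) :=
  (hf.fderiv_right (m := ∞) (by simp)).clm_apply contDiff_const

theorem _root_.ContDiff.pd₁_iterate {f : ℂ → ℂ} (hf : ContDiff ℝ ∞ f) (k : ℕ) :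
    ContDiff ℝ ∞ (WeightedCR.pd₁^[k] f) := by
  induction k with
  | zero => exact hf
  | succ k ih =>
    rw [Function.iterate_succ_apply']
    exact ih.pd₁

theorem _root_.ContDiff.pd₂ {f : ℂ → ℂ} (hf : ContDiff ℝ ∞ f) : ContDiff ℝ ∞ (pd₂ f) :=
  (hf.fderiv_right (m := ∞) (by simp)).clm_apply contDiff_const

theorem _root_.ContDiff.dbar {f : ℂ → ℂ} (hf : ContDiff ℝ ∞ f) : ContDiff ℝ ∞ (dbar f) :=
  contDiff_const.mul (hf.pd₁.add (contDiff_const.mul hf.pd₂))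

theorem tsupport_pd₁_subset (f : ℂ → ℂ) : tsupport (pd₁ f) ⊆ tsupport f :=
  tsupport_fderiv_apply_subset ℝ 1

theorem tsupport_pd₁_iterate_subset (f : ℂ → ℂ) (k : ℕ) :
    tsupport (pd₁^[k] f) ⊆ tsupport f := by
  induction k with
  | zero => exact Subset.rfl
  | succ k ih =>
    rw [Function.iterate_succ_apply']
    exact (tsupport_pd₁_subset _).trans ih

theorem tsupport_pd₂_subset (f : ℂ → ℂ) : tsupport (pd₂ f) ⊆ tsupport f :=
  tsupport_fderiv_apply_subset ℝ Complex.I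

theorem tsupport_dbar_subset (f : ℂ → ℂ) : tsupport (dbar f) ⊆ tsupport f := by
  refine closure_minimal (fun z hz => ?_) (isClosed_tsupport f)
  by_contra h
  refine hz ?_
  have h₁ : pd₁ f z = 0 := by_contra fun h' =>
    h (tsupport_pd₁_subset f (subset_tsupport _ h'))
  have h₂ : pd₂ f z = 0 := by_contra fun h' =>
    h (tsupport_pd₂_subset f (subset_tsupport _ h'))
  simp [dbar, h₁, h₂]

theorem pd₁_add {f g : ℂ → ℂ} {z : ℂ} (hf : DifferentiableAt ℝ f z)
    (hg : DifferentiableAt ℝ g z) : pd₁ (f + g) z = pd₁ f z + pd₁ g z := by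
  simp [pd₁, fderiv_add hf hg]

theorem pd₁_mul {f g : ℂ → ℂ} {z : ℂ} (hf : DifferentiableAt ℝ f z)
    (hg : DifferentiableAt ℝ g z) : pd₁ (f * g) z = pd₁ f z * g z + f z * pd₁ g z := by
  simp [pd₁, fderiv_mul hf hg]
  ring

theorem pd₂_mul {f g : ℂ → ℂ} {z : ℂ} (hf : DifferentiableAt ℝ f z)
    (hg : DifferentiableAt ℝ g z) : pd₂ (f * g) z = pd₂ f z * g z + f z * pd₂ g z := by
  simp [pd₂, fderiv_mul hf hg]
  ring

theorem dbar_mul {f g : ℂ → ℂ} {z : ℂ} (hf : DifferentiableAt ℝ f z)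
    (hg : DifferentiableAt ℝ g z) : dbar (f * g) z = dbar f z * g z + f z * dbar g z := by
  simp only [dbar, pd₁_mul hf hg, pd₂_mul hf hg]
  ring

theorem _root_.ContDiffOn.differentiableAt_real {U : Set ℂ} (hU : IsOpen U) {f : ℂ → ℂ}
    (hf : ContDiffOn ℝ ∞ f U) {z : ℂ} (hz : z ∈ U) : DifferentiableAt ℝ f z :=
  (hf.contDiffAt (hU.mem_nhds hz)).differentiableAt (by simp)

theorem pd₁_iterate_add {U : Set ℂ} (hU : IsOpen U) (k : ℕ) {f g : ℂ → ℂ}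
    (hf : ContDiffOn ℝ ∞ f U) (hg : ContDiffOn ℝ ∞ g U) :
    EqOn (pd₁^[k] (f + g)) (pd₁^[k] f + pd₁^[k] g) U := by
  induction k generalizing f g with
  | zero => exact fun _ _ => rfl
  | succ k ih =>
    intro z hz
    simp only [Function.iterate_succ_apply]
    have h : EqOn (pd₁ (f + g)) (pd₁ f + pd₁ g) U := fun w hw =>
      pd₁_add (hf.differentiableAt_real hU hw) (hg.differentiableAt_real hU hw)
    rw [h.pd₁_iterate hU k hz]
    exact ih (hf.pd₁ hU) (hg.pd₁ hU) hz

theorem pd₁_iterate_sub {U : Set ℂ} (hU : IsOpen U) (k : ℕ) {f g : ℂ → ℂ}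
    (hf : ContDiffOn ℝ ∞ f U) (hg : ContDiffOn ℝ ∞ g U) :
    EqOn (pd₁^[k] (f - g)) (pd₁^[k] f - pd₁^[k] g) U := fun z hz => by
  have h := pd₁_iterate_add hU k (f := f - g) (hf.sub hg) hg hz
  rw [sub_add_cancel] at h
  exact eq_sub_of_add_eq h.symm

/-- A form of the Leibniz rule: bounds for the derivatives of the factors give bounds for the
derivatives of the product. -/
theorem norm_pd₁_iterate_mul_le {U : Set ℂ} (hU : IsOpen U) {z : ℂ} (hz : z ∈ U) {a b : ℝ} (k : ℕ)
    {f g : ℂ → ℂ} (hf : ContDiffOn ℝ ∞ f U) (hg : ContDiffOn ℝ ∞ g U)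
    (ha : ∀ j ≤ k, ‖pd₁^[j] f z‖ ≤ a) (hb : ∀ j ≤ k, ‖pd₁^[j] g z‖ ≤ b) :
    ‖pd₁^[k] (f * g) z‖ ≤ 2 ^ k * (a * b) := by
  induction k generalizing f g with
  | zero =>
    simpa using mul_le_mul (ha 0 le_rfl) (hb 0 le_rfl) (norm_nonneg _)
      ((norm_nonneg _).trans (ha 0 le_rfl))
  | succ k ih =>
    rw [Function.iterate_succ_apply]
    have h : EqOn (pd₁ (f * g)) (pd₁ f * g + f * pd₁ g) U := fun w hw =>
      pd₁_mul (hf.differentiableAt_real hU hw) (hg.differentiableAt_real hU hw)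
    rw [h.pd₁_iterate hU k hz, pd₁_iterate_add hU k (f := pd₁ f * g) (g := f * pd₁ g)
      ((hf.pd₁ hU).mul hg) (hf.mul (hg.pd₁ hU)) hz]
    have h₁ := ih (hf.pd₁ hU) hg (fun j hj => by
      simpa [Function.iterate_succ_apply] using ha (j + 1) (by omega))
      (fun j hj => hb j (by omega))
    have h₂ := ih hf (hg.pd₁ hU) (fun j hj => ha j (by omega)) (fun j hj => by
      simpa [Function.iterate_succ_apply] using hb (j + 1) (by omega))
    refine (norm_add_le _ _).trans ((add_le_add h₁ h₂).trans_eq ?_)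
    ring

/-! ### Holomorphic functions -/

theorem pd₁_eq_deriv {f : ℂ → ℂ} {z : ℂ} (hf : DifferentiableAt ℂ f z) : pd₁ f z = deriv f z := by
  simp [pd₁, hf.fderiv_restrictScalars ℝ]

theorem pd₂_eq_deriv {f : ℂ → ℂ} {z : ℂ} (hf : DifferentiableAt ℂ f z) :
    pd₂ f z = Complex.I * deriv f z := by
  rw [pd₂, hf.fderiv_restrictScalars ℝ, ContinuousLinearMap.coe_restrictScalars',
    fderiv_eq_smul_deriv, smul_eq_mul]

theorem dbar_eq_zero {f : ℂ → ℂ} {z : ℂ} (hf : DifferentiableAt ℂ f z) : dbar f z = 0 := by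
  rw [dbar, pd₁_eq_deriv hf, pd₂_eq_deriv hf, ← mul_assoc, Complex.I_mul_I]
  ring

theorem differentiableAt_of_dbar_eq_zero {f : ℂ → ℂ} {z : ℂ} (hf : DifferentiableAt ℝ f z)
    (h : dbar f z = 0) : DifferentiableAt ℂ f z := by
  refine differentiableAt_complex_iff_differentiableAt_real.2 ⟨hf, ?_⟩
  have h' : pd₁ f z + Complex.I * pd₂ f z = 0 := by simpa [dbar] using h
  change pd₂ f z = Complex.I * pd₁ f z
  linear_combination (-Complex.I) * h' + pd₂ f z * Complex.I_mul_I

theorem _root_.DifferentiableOn.iteratedDeriv {U : Set ℂ} (hU : IsOpen U) {f : ℂ → ℂ}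
    (hf : DifferentiableOn ℂ f U) (k : ℕ) : DifferentiableOn ℂ (iteratedDeriv k f) U := by
  induction k with
  | zero => simpa using hf
  | succ k ih =>
    rw [iteratedDeriv_succ]
    exact ih.deriv hU

/-- For holomorphic functions `∂₂ = i ∂₁`, so `|∂^β f|` depends only on the order of `β`. This is
why the later estimates involve only complex derivatives or iterates of `pd₁`. -/
theorem pd_eq_iteratedDeriv {U : Set ℂ} (hU : IsOpen U) {f : ℂ → ℂ}
    (hf : DifferentiableOn ℂ f U) (β : ℕ × ℕ) :
    EqOn (pd β f) (fun z => Complex.I ^ β.2 * iteratedDeriv (β.1 + β.2) f z) U := by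
  obtain ⟨a, b⟩ := β
  have hd (k : ℕ) {z : ℂ} (hz : z ∈ U) : DifferentiableAt ℂ (iteratedDeriv k f) z :=
    (hf.iteratedDeriv hU k).differentiableAt (hU.mem_nhds hz)
  have h₂ : EqOn (pd₂^[b] f) (fun z => Complex.I ^ b * iteratedDeriv b f z) U := by
    induction b with
    | zero => intro z _; simp
    | succ b ih =>
      rw [Function.iterate_succ_apply']
      intro z hz
      rw [ih.pd₂ hU hz, pd₂_eq_deriv ((hd b hz).const_mul _), deriv_const_mul _ (hd b hz),
        iteratedDeriv_succ]
      ring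
  simp only [pd]
  induction a with
  | zero => simpa using h₂
  | succ a ih =>
    rw [Function.iterate_succ_apply']
    intro z hz
    rw [ih.pd₁ hU hz, pd₁_eq_deriv ((hd _ hz).const_mul _), deriv_const_mul _ (hd _ hz)]
    dsimp only
    rw [show a + 1 + b = a + b + 1 by ring, iteratedDeriv_succ]

theorem pd₁_iterate_eq_iteratedDeriv {U : Set ℂ} (hU : IsOpen U) {f : ℂ → ℂ}
    (hf : DifferentiableOn ℂ f U) (k : ℕ) : EqOn (pd₁^[k] f) (iteratedDeriv k f) U := by
  simpa [pd] using pd_eq_iteratedDeriv hU hf (k, 0)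

theorem norm_pd_eq {U : Set ℂ} (hU : IsOpen U) {f : ℂ → ℂ}
    (hf : DifferentiableOn ℂ f U) (β : ℕ × ℕ) {z : ℂ} (hz : z ∈ U) :
    ‖pd β f z‖ = ‖iteratedDeriv (β.1 + β.2) f z‖ := by
  rw [pd_eq_iteratedDeriv hU hf β hz]
  simp

theorem _root_.DifferentiableOn.contDiffOn_real {U : Set ℂ} (hU : IsOpen U) {f : ℂ → ℂ}
    (hf : DifferentiableOn ℂ f U) : ContDiffOn ℝ ∞ f U :=
  (hf.contDiffOn hU).restrict_scalars ℝ

/-! ### The weighted spaces of holomorphic functions -/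

theorem zeroExt_apply {U : Set ℂ} (f : U → ℂ) (x : U) : zeroExt f x = f x :=
  Subtype.val_injective.extend_apply f 0 x

theorem zeroExt_of_mem {U : Set ℂ} (f : U → ℂ) {x : ℂ} (hx : x ∈ U) : zeroExt f x = f ⟨x, hx⟩ :=
  zeroExt_apply f ⟨x, hx⟩

theorem eqOn_zeroExt {U : Set ℂ} (f : ℂ → ℂ) : EqOn (zeroExt fun x : U => f x) f U :=
  fun _ hx => zeroExt_of_mem _ hx

theorem _root_.Set.EqOn.iteratedDeriv {U : Set ℂ} (hU : IsOpen U) {f g : ℂ → ℂ} (h : EqOn f g U)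
    (k : ℕ) : EqOn (iteratedDeriv k f) (iteratedDeriv k g) U := fun _ hz =>
  (h.eventuallyEq_of_mem (hU.mem_nhds hz)).iteratedDeriv_eq k

namespace WeightSystem

variable (S : WeightSystem)

theorem dom_subset_Om (n : ℕ) : S.dom n ⊆ S.Om := by
  rw [S.iUnion_dom]
  exact subset_iUnion _ n

theorem ν_mono {n k : ℕ} (h : n ≤ k) {x : ℂ} (hx : x ∈ S.Om) : S.ν n x ≤ S.ν k x :=
  monotone_nat_of_le_succ (f := fun n => S.ν n x) (fun n => S.ν_le_succ n x hx) h

theorem ν_nonneg (n : ℕ) {x : ℂ} (hx : x ∈ S.Om) : 0 ≤ S.ν n x := (S.ν_pos n x hx).le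

theorem seminorm_le {n m : ℕ} {f : S.dom n → ℂ} (hf : DifferentiableOn ℂ (zeroExt f) (S.dom n))
    {C : ℝ} (h : ∀ k ≤ m, ∀ x ∈ S.dom n, ‖iteratedDeriv k (zeroExt f) x‖ * S.ν n x ≤ C) :
    S.seminorm n m f ≤ ENNReal.ofReal C :=
  iSup_le fun x => iSup₂_le fun β hβ => ENNReal.ofReal_le_ofReal <| by
    rw [norm_pd_eq (S.isOpen_dom n) hf β x.2]
    exact h _ hβ _ x.2

theorem mem_dbarSpace_iff {n : ℕ} {f : S.dom n → ℂ} :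
    f ∈ S.dbarSpace n ↔ DifferentiableOn ℂ (zeroExt f) (S.dom n) ∧
      ∀ k, ∃ C : ℝ, ∀ x ∈ S.dom n, ‖iteratedDeriv k (zeroExt f) x‖ * S.ν n x ≤ C := by
  constructor
  · rintro ⟨⟨h₁, h₂⟩, h₃⟩
    have hd : DifferentiableOn ℂ (zeroExt f) (S.dom n) := fun x hx =>
      (differentiableAt_of_dbar_eq_zero (h₁.differentiableAt_real (S.isOpen_dom n) hx)
        (h₃ ⟨x, hx⟩)).differentiableWithinAt
    refine ⟨hd, fun k => ⟨(S.seminorm n k f).toReal, fun x hx => ?_⟩⟩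
    rw [← ENNReal.ofReal_le_iff_le_toReal (h₂ k).ne]
    have h : ENNReal.ofReal (‖pd (k, 0) (zeroExt f) x‖ * S.ν n x) ≤ S.seminorm n k f :=
      le_iSup_of_le ⟨x, hx⟩ (le_iSup₂_of_le (k, 0) (by simp) le_rfl)
    rwa [norm_pd_eq (S.isOpen_dom n) hd _ hx] at h
  · rintro ⟨hd, hC⟩
    refine ⟨⟨hd.contDiffOn_real (S.isOpen_dom n), fun m => ?_⟩, fun x =>
      dbar_eq_zero (hd.differentiableAt ((S.isOpen_dom n).mem_nhds x.2))⟩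
    choose C hC using hC
    refine (S.seminorm_le (C := ∑ k ∈ Finset.range (m + 1), |C k|) hd fun k hk x hx => ?_).trans_lt
      ENNReal.ofReal_lt_top
    refine ((hC k x hx).trans (le_abs_self _)).trans ?_
    exact Finset.single_le_sum (f := fun k => |C k|) (fun _ _ => abs_nonneg _)
      (Finset.mem_range.2 (by omega))

theorem eqOn_zeroExt_res {k n : ℕ} (h : n ≤ k) (f : S.dom k → ℂ) :
    EqOn (zeroExt (S.res h f)) (zeroExt f) (S.dom n) := fun x hx => by
  rw [zeroExt_of_mem _ hx, zeroExt_of_mem _ (S.dom_mono h hx)]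
  rfl

theorem res_mem_dbarSpace {k n : ℕ} (h : n ≤ k) {f : S.dom k → ℂ} (hf : f ∈ S.dbarSpace k) :
    S.res h f ∈ S.dbarSpace n := by
  rw [mem_dbarSpace_iff] at hf ⊢
  have he := S.eqOn_zeroExt_res h f
  refine ⟨(hf.1.mono (S.dom_mono h)).congr he, fun j => ?_⟩
  obtain ⟨C, hC⟩ := hf.2 j
  refine ⟨C, fun x hx => ?_⟩
  rw [he.iteratedDeriv (S.isOpen_dom n) j hx]
  exact (mul_le_mul_of_nonneg_left (S.ν_mono h (S.dom_subset_Om n hx)) (norm_nonneg _)).trans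
    (hC x (S.dom_mono h hx))

end WeightSystem

/-! ### The Cauchy-Pompeiu formula -/

/-- Rotating the frame `(1, i)` by `θ` multiplies the Cauchy-Riemann operator by `e^{-iθ}`. -/
theorem fderiv_polar_eq_dbar (f : ℂ → ℂ) (z : ℂ) (θ : ℝ) :
    fderiv ℝ f z (Complex.exp (θ * Complex.I)) +
      Complex.I * fderiv ℝ f z (Complex.exp (θ * Complex.I) * Complex.I) =
      2 * Complex.exp (-(θ * Complex.I)) * dbar f z := by
  have h₁ : Complex.exp (θ * Complex.I) = Real.cos θ • (1 : ℂ) + Real.sin θ • Complex.I := by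
    rw [Complex.exp_mul_I]; simp
  have h₂ : Complex.exp (-(θ * Complex.I)) = Real.cos θ - Real.sin θ * Complex.I := by
    rw [← neg_mul, Complex.exp_mul_I]; simp; ring
  have h₃ : (Real.cos θ • (1 : ℂ) + Real.sin θ • Complex.I) * Complex.I =
      Real.cos θ • Complex.I - Real.sin θ • (1 : ℂ) := by
    simp only [Complex.real_smul]
    linear_combination (Real.sin θ : ℂ) * Complex.I_mul_I
  rw [h₁, h₂, h₃]
  rw [map_add, map_sub, map_smul, map_smul, map_smul, map_smul]
  simp only [dbar, pd₁, pd₂]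
  simp only [Complex.real_smul]
  linear_combination ((Real.sin θ : ℂ) * fderiv ℝ f z Complex.I) * Complex.I_mul_I

/-- In polar coordinates the Jacobian `r` cancels the singularity, leaving half of `A + iB`. The
radial derivative `A` integrates to `-f(0)` along each ray. For `r > 0`, `rB(r, ·)` is the
derivative of the periodic function `θ ↦ f(r e^{iθ})`, so `B` integrates to `0` over each circle. -/
theorem integral_dbar_div {f : ℂ → ℂ} (hf : ContDiff ℝ 1 f) (hc : HasCompactSupport f) :
    ∫ y, dbar f y / y = -(Real.pi * f 0) := by
  have hcont : Continuous fun q : ℂ × ℂ => fderiv ℝ f q.1 q.2 := by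
    have := hf.continuous_fderiv one_ne_zero
    fun_prop
  set e : ℝ → ℂ := fun θ => Complex.exp (θ * Complex.I) with he
  have hec : Continuous e := by fun_prop
  have hen (θ : ℝ) : ‖e θ‖ = 1 := Complex.norm_exp_ofReal_mul_I θ
  obtain ⟨R, hR, hfR⟩ := hc.exists_pos_le_norm
  have hdR : ∀ z : ℂ, R < ‖z‖ → fderiv ℝ f z = 0 := fun z hz => by
    have : f =ᶠ[𝓝 z] fun _ => 0 := by
      filter_upwards [(isOpen_lt continuous_const continuous_norm).mem_nhds hz] with w hw
      exact hfR w hw.le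
    rw [this.fderiv_eq]; simp
  -- the radial and the angular derivative, as functions of the polar coordinates
  set A : ℝ × ℝ → ℂ := fun p => fderiv ℝ f (p.1 * e p.2) (e p.2) with hA
  set B : ℝ × ℝ → ℂ := fun p => fderiv ℝ f (p.1 * e p.2) (e p.2 * Complex.I) with hB
  have hAc : Continuous A := hcont.comp (f := fun p : ℝ × ℝ => ((p.1 * e p.2 : ℂ), e p.2))
    (by fun_prop)
  have hBc : Continuous B := hcont.comp
    (f := fun p : ℝ × ℝ => ((p.1 * e p.2 : ℂ), e p.2 * Complex.I)) (by fun_prop)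
  have hint : ∀ F : ℝ × ℝ → ℂ, Continuous F → (∀ p, R < p.1 → F p = 0) →
      IntegrableOn F (Ioi 0 ×ˢ Ioo (-Real.pi) Real.pi) (volume.prod volume) := by
    intro F hF h0
    have h₁ : IntegrableOn F (Icc 0 R ×ˢ Icc (-Real.pi) Real.pi) (volume.prod volume) :=
      hF.continuousOn.integrableOn_compact (isCompact_Icc.prod isCompact_Icc)
    refine h₁.of_forall_sdiff_eq_zero (measurableSet_Ioi.prod measurableSet_Ioo) ?_
    rintro ⟨r, θ⟩ ⟨⟨hr, hθ⟩, hn⟩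
    refine h0 _ (not_le.1 fun hle => hn ⟨⟨le_of_lt hr, hle⟩, Ioo_subset_Icc_self hθ⟩)
  have hnorm (p : ℝ × ℝ) (hp : R < p.1) : R < ‖(p.1 * e p.2 : ℂ)‖ := by
    rw [norm_mul, hen, mul_one, Complex.norm_real]
    exact hp.trans_le (le_abs_self _)
  have hAi := hint A hAc fun p hp => by simp [hA, hdR _ (hnorm p hp)]
  have hBi := hint B hBc fun p hp => by simp [hB, hdR _ (hnorm p hp)]
  have hfd (z : ℂ) : HasFDerivAt f (fderiv ℝ f z) z :=
    (hf.differentiable one_ne_zero z).hasFDerivAt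
  have hA0 : ∫ p in Ioi 0 ×ˢ Ioo (-Real.pi) Real.pi, A p = -(2 * Real.pi * f 0) := by
    rw [Measure.volume_eq_prod, ← Measure.prod_restrict, integral_prod_symm _
      (by rwa [Measure.prod_restrict])]
    have : ∀ θ : ℝ, ∫ r in Ioi (0 : ℝ), A (r, θ) = -f 0 := by
      intro θ
      have hd (r : ℝ) : HasDerivAt (fun r : ℝ => f (r * e θ)) (A (r, θ)) r := by
        have h := (hfd (r * e θ)).comp_hasDerivAt r
          ((Complex.ofRealCLM.hasDerivAt (x := r)).mul_const (e θ))
        simpa [hA, Function.comp_def] using! h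
      have hdd : deriv (fun r : ℝ => f (r * e θ)) = fun r => A (r, θ) := funext fun r => (hd r).deriv
      have h := HasCompactSupport.integral_Ioi_deriv_eq (f := fun r : ℝ => f (r * e θ))
        (hf.comp ((Complex.ofRealCLM.contDiff).mul contDiff_const)) ?_ 0
      · rw [hdd] at h
        simpa using h
      · refine HasCompactSupport.of_support_subset_isCompact (isCompact_Icc (a := -R) (b := R)) ?_
        intro r hr
        by_contra hn
        refine hr (hfR _ ?_)
        rw [norm_mul, hen, mul_one, Complex.norm_real]
        by_contra hlt
        exact hn (abs_le.1 (not_le.1 hlt).le)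
    simp only [this]
    simp [Real.pi_pos.le]
    exact Or.inl (two_mul _).symm
  have hB0 : ∫ p in Ioi 0 ×ˢ Ioo (-Real.pi) Real.pi, B p = 0 := by
    rw [Measure.volume_eq_prod, setIntegral_prod _ hBi]
    refine setIntegral_eq_zero_of_forall_eq_zero fun r hr => ?_
    have hr' : (r : ℂ) ≠ 0 := by simpa using (ne_of_gt hr : r ≠ 0)
    have hd (θ : ℝ) : HasDerivAt (fun θ : ℝ => f (r * e θ)) (r * B (r, θ)) θ := by
      have h₁ : HasDerivAt e (e θ * Complex.I) θ := by
        have := ((Complex.ofRealCLM.hasDerivAt (x := θ)).mul_const Complex.I).cexp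
        simpa [he] using this
      have h := (hfd (r * e θ)).comp_hasDerivAt θ (h₁.const_mul (r : ℂ))
      have h₂ : (r : ℂ) * (e θ * Complex.I) = r • (e θ * Complex.I) := by simp
      rw [h₂, map_smul, Complex.real_smul] at h
      exact h
    have h := intervalIntegral.integral_eq_sub_of_hasDerivAt (a := -Real.pi) (b := Real.pi)
      (fun θ _ => hd θ) (Continuous.intervalIntegrable (by fun_prop) _ _)
    have h₃ : e Real.pi = e (-Real.pi) := by
      simp [he, Complex.exp_pi_mul_I, Complex.exp_neg]
    rw [h₃, sub_self, intervalIntegral.integral_const_mul] at h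
    rw [← integral_Ioc_eq_integral_Ioo, ← intervalIntegral.integral_of_le (by linarith [Real.pi_pos])]
    exact (mul_eq_zero.1 h).resolve_left hr'
  rw [← Complex.integral_comp_polarCoord_symm]
  have hcongr : ∀ p ∈ polarCoord.target, p.1 • (dbar f (Complex.polarCoord.symm p) /
      Complex.polarCoord.symm p) = (1 / 2 : ℂ) * (A p + Complex.I * B p) := by
    rintro ⟨r, θ⟩ ⟨hr, -⟩
    have hr' : (r : ℂ) ≠ 0 := by simpa using (ne_of_gt hr : r ≠ 0)
    have hsymm : Complex.polarCoord.symm (r, θ) = r * e θ := by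
      rw [Complex.polarCoord_symm_apply, he]
      simp [Complex.exp_mul_I]
    rw [hsymm, hA, hB]
    dsimp only
    rw [fderiv_polar_eq_dbar, Complex.exp_neg]
    have := Complex.exp_ne_zero (θ * Complex.I)
    simp only [he, Complex.real_smul]
    field_simp
  rw [setIntegral_congr_fun polarCoord.open_target.measurableSet hcongr, polarCoord_target,
    integral_const_mul, Measure.volume_eq_prod, integral_add hAi (hBi.const_mul _), integral_const_mul, ← Measure.volume_eq_prod]
  rw [hA0, hB0]
  ring

/-- The fundamental solution of the Cauchy-Riemann operator given by an entire function `g` with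
`g 0 = 1`. -/
noncomputable def cauchyKernel (g : ℂ → ℂ) (z : ℂ) : ℂ := g z / (Real.pi * z)

/-- Apply `integral_dbar_div` to `y ↦ g(-y) f(z + y)`: the holomorphic factor passes through `∂̄`,
and the value at `0` is `f(z)`. -/
theorem cauchyKernel_conv_dbar {g : ℂ → ℂ} (hg : Differentiable ℂ g) (hg0 : g 0 = 1) {f : ℂ → ℂ}
    (hf : ContDiff ℝ ∞ f) (hc : HasCompactSupport f) (z : ℂ) :
    ∫ y, cauchyKernel g (z - y) * dbar f y = f z := by
  have hgr : ContDiff ℝ ∞ g := (hg.contDiff (n := ∞)).restrict_scalars ℝ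
  set F : ℂ → ℂ := fun y => g (-y) * f (z + y)
  have hF : ContDiff ℝ ∞ F := (hgr.comp contDiff_neg).mul (hf.comp (contDiff_const.add contDiff_id))
  have hFc : HasCompactSupport F :=
    (hc.comp_homeomorph (Homeomorph.addLeft z)).mul_left
  have hdF (y : ℂ) : dbar F y = g (-y) * dbar f (z + y) := by
    have h₁ : DifferentiableAt ℂ (fun y => g (-y)) y := by fun_prop
    have h₂ : DifferentiableAt ℝ (fun y => f (z + y)) y :=
      ((hf.comp (contDiff_const.add contDiff_id)).differentiable (by simp)) y
    have h := dbar_mul (h₁.restrictScalars ℝ) h₂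
    rw [dbar_eq_zero h₁, zero_mul, zero_add] at h
    change dbar F y = _ at h
    rw [h]
    simp only [dbar, pd₁, pd₂, fderiv_comp_add_left]
  have h := integral_dbar_div (hF.of_le (by simp)) hFc
  have hpi : (Real.pi : ℂ) ≠ 0 := by exact_mod_cast Real.pi_ne_zero
  rw [← integral_add_left_eq_self _ z]
  have he : (fun y => cauchyKernel g (z - (z + y)) * dbar f (z + y)) =
      fun y => -(Real.pi : ℂ)⁻¹ * (dbar F y / y) := by
    ext y
    rw [hdF, cauchyKernel, sub_add_cancel_left]
    simp only [div_eq_mul_inv, mul_inv, inv_neg]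
    ring
  rw [he, integral_const_mul, h]
  simp [F, hg0, hpi]

/-- An `L¹`-bound for the values of a holomorphic function at the centre of a disc. -/
theorem exists_enorm_le_lintegral_ball {δ : ℝ} (hδ : 0 < δ) :
    ∃ C : ℝ, 0 ≤ C ∧ ∀ (h : ℂ → ℂ) (w : ℂ), DifferentiableOn ℂ h (Metric.ball w δ) →
      ‖h w‖ₑ ≤ ENNReal.ofReal C * ∫⁻ y in Metric.ball w δ, ‖h y‖ₑ := by
  let ρ : ContDiffBump (0 : ℂ) := ⟨δ / 3, δ / 2, by positivity, by linarith⟩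
  set r : ℂ → ℂ := fun z => (ρ z : ℂ) with hr
  have hrs : ContDiff ℝ ∞ r := Complex.ofRealCLM.contDiff.comp ρ.contDiff
  have hrc : HasCompactSupport r := ρ.hasCompactSupport.comp_left (g := fun x : ℝ => (x : ℂ)) (by simp)
  have hts : tsupport r ⊆ Metric.closedBall 0 (δ / 2) := by
    refine closure_minimal (fun z hz => ?_) Metric.isClosed_closedBall
    refine Metric.ball_subset_closedBall ?_
    have : z ∈ Function.support ρ := fun h => hz (by simp [hr, h])
    rwa [ρ.support_eq] at this
  have hdb : Continuous (dbar r) := hrs.dbar.continuous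
  obtain ⟨M, hM⟩ := (hrc.of_isClosed_subset (isClosed_tsupport _)
    (tsupport_dbar_subset r)).exists_bound_of_continuousOn hdb.continuousOn
  have hM' (y : ℂ) : ‖dbar r y‖ ≤ max M 0 := by
    by_cases hy : y ∈ tsupport (dbar r)
    · exact (hM y hy).trans (le_max_left _ _)
    · simp [image_eq_zero_of_notMem_tsupport hy]
  have hnear (y : ℂ) (hy : y ∈ Metric.ball (0 : ℂ) (δ / 3)) : dbar r y = 0 := by
    have : EqOn r (fun _ => 1) (Metric.ball (0 : ℂ) (δ / 3)) := fun z hz => by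
      simp [hr, ρ.one_of_mem_closedBall (Metric.ball_subset_closedBall hz)]
    rw [dbar_congr Metric.isOpen_ball this hy]
    exact dbar_eq_zero (by fun_prop)
  -- The bound comes from `integral_dbar_div` for `r * h₀`. Since `h₀` is holomorphic, `∂̄` falls on
  -- `r` alone, and `∂̄r` vanishes for `|y| < δ/3`, so `1/|y|` costs at most `3/δ`.
  refine ⟨Real.pi⁻¹ * (max M 0 / (δ / 3)), by positivity, fun h w hh => ?_⟩
  set h₀ : ℂ → ℂ := fun y => h (w + y) with hh₀
  have hmaps : MapsTo (fun y => w + y) (Metric.ball 0 δ) (Metric.ball w δ) := fun y hy => by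
    simpa [dist_eq_norm] using hy
  have hd : DifferentiableOn ℂ h₀ (Metric.ball 0 δ) :=
    hh.comp (by fun_prop) hmaps
  have hd' := hd.contDiffOn_real Metric.isOpen_ball
  have htsub : tsupport r ⊆ Metric.ball 0 δ :=
    hts.trans (Metric.closedBall_subset_ball (by linarith))
  have hsm : ContDiff ℝ ∞ (r * h₀) := by
    rw [contDiff_iff_contDiffAt]
    intro z
    by_cases hz : z ∈ Metric.ball (0 : ℂ) δ
    · exact hrs.contDiffAt.mul (hd'.contDiffAt (Metric.isOpen_ball.mem_nhds hz))
    · have h0 : r =ᶠ[𝓝 z] 0 := notMem_tsupport_iff_eventuallyEq.1 fun h => hz (htsub h)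
      refine (contDiffAt_const (c := (0 : ℂ))).congr_of_eventuallyEq ?_
      filter_upwards [h0] with y hy
      simp [hy]
  have key := integral_dbar_div (hsm.of_le (by simp)) hrc.mul_right
  have hr0 : r 0 = 1 := by
    simp [hr, ρ.one_of_mem_closedBall (Metric.mem_closedBall_self ρ.rIn_pos.le)]
  have hw : h w = -(Real.pi : ℂ)⁻¹ * ∫ y, dbar (r * h₀) y / y := by
    have hpi : (Real.pi : ℂ) ≠ 0 := by exact_mod_cast Real.pi_ne_zero
    rw [key, Pi.mul_apply, hr0, hh₀]
    simp [hpi]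
  have hbd (y : ℂ) : ‖dbar (r * h₀) y / y‖ₑ ≤
      (Metric.ball 0 δ).indicator
        (fun y => ENNReal.ofReal (max M 0 / (δ / 3)) * ‖h₀ y‖ₑ) y := by
    by_cases hy : y ∈ tsupport r
    · have hyb := htsub hy
      rw [indicator_of_mem hyb, dbar_mul (hrs.differentiable (by simp) y)
        (hd'.differentiableAt_real Metric.isOpen_ball hyb),
        dbar_eq_zero (hd.differentiableAt (Metric.isOpen_ball.mem_nhds hyb)), mul_zero, add_zero,
        ← ofReal_norm, ← ofReal_norm, ← ENNReal.ofReal_mul (by positivity)]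
      refine ENNReal.ofReal_le_ofReal ?_
      by_cases hyn : y ∈ Metric.ball (0 : ℂ) (δ / 3)
      · rw [hnear y hyn, zero_mul, zero_div, norm_zero]
        positivity
      · have hyn' : δ / 3 ≤ ‖y‖ := by simpa using hyn
        rw [norm_div, norm_mul, div_mul_eq_mul_div]
        gcongr
        exact hM' y
    · have : dbar (r * h₀) y = 0 := by
        refine image_eq_zero_of_notMem_tsupport fun h' => hy ?_
        exact tsupport_mul_subset_left (tsupport_dbar_subset _ h')
      simp [this]
  have hshift : ∫⁻ y in Metric.ball 0 δ, ‖h₀ y‖ₑ = ∫⁻ y in Metric.ball w δ, ‖h y‖ₑ := by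
    rw [← lintegral_indicator Metric.isOpen_ball.measurableSet,
      ← lintegral_indicator Metric.isOpen_ball.measurableSet,
      ← lintegral_add_left_eq_self (fun y => (Metric.ball w δ).indicator _ y) w]
    congr 1 with y
    simp [indicator, hh₀, dist_eq_norm]
  rw [hw, enorm_mul, ENNReal.ofReal_mul (by positivity), mul_assoc]
  gcongr
  · rw [← ofReal_norm]
    refine ENNReal.ofReal_le_ofReal ?_
    simp [abs_of_pos Real.pi_pos]
  · refine (enorm_integral_le_lintegral_enorm _).trans ((lintegral_mono hbd).trans ?_)
    rw [lintegral_indicator Metric.isOpen_ball.measurableSet,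
      lintegral_const_mul' _ _ ENNReal.ofReal_ne_top, hshift]

/-! ### Convolutions -/

/-- The convolution of two functions on the plane. -/
noncomputable def conv (u φ : ℂ → ℂ) (z : ℂ) : ℂ := ∫ y, u (z - y) * φ y

open scoped Convolution in
theorem conv_eq_convolution (u φ : ℂ → ℂ) :
    conv u φ = u ⋆[ContinuousLinearMap.mul ℝ ℂ, volume] φ := by
  ext z
  rw [convolution_eq_swap]
  rfl

theorem integrable_conv {u φ : ℂ → ℂ} (hu : LocallyIntegrable u) (hφ : Continuous φ)
    (hc : HasCompactSupport φ) (z : ℂ) : Integrable fun y => u (z - y) * φ y :=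
  (HasCompactSupport.convolutionExists_right (ContinuousLinearMap.mul ℝ ℂ) hc hu hφ z).integrable_swap

theorem contDiff_conv {u φ : ℂ → ℂ} (hu : LocallyIntegrable u) (hφ : ContDiff ℝ ∞ φ)
    (hc : HasCompactSupport φ) : ContDiff ℝ ∞ (conv u φ) := by
  rw [conv_eq_convolution]
  exact hc.contDiff_convolution_right _ hu hφ

theorem fderiv_conv_apply {u φ : ℂ → ℂ} (hu : LocallyIntegrable u) (hφ : ContDiff ℝ ∞ φ)
    (hc : HasCompactSupport φ) (z v : ℂ) :
    fderiv ℝ (conv u φ) z v = conv u (fun y => fderiv ℝ φ y v) z := by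
  have h := hc.hasFDerivAt_convolution_right (ContinuousLinearMap.mul ℝ ℂ) hu (hφ.of_le (by simp)) z
  rw [conv_eq_convolution, conv_eq_convolution, h.fderiv,
    convolution_precompR_apply _ hu (hc.fderiv ℝ) (hφ.continuous_fderiv (by simp))]

theorem _root_.HasCompactSupport.pd₁ {φ : ℂ → ℂ} (hc : HasCompactSupport φ) :
    HasCompactSupport (pd₁ φ) := hc.of_isClosed_subset (isClosed_tsupport _) (tsupport_pd₁_subset φ)

theorem _root_.HasCompactSupport.pd₂ {φ : ℂ → ℂ} (hc : HasCompactSupport φ) :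
    HasCompactSupport (pd₂ φ) := hc.of_isClosed_subset (isClosed_tsupport _) (tsupport_pd₂_subset φ)

theorem _root_.HasCompactSupport.dbar {φ : ℂ → ℂ} (hc : HasCompactSupport φ) :
    HasCompactSupport (dbar φ) := hc.of_isClosed_subset (isClosed_tsupport _) (tsupport_dbar_subset φ)

theorem pd₁_iterate_conv {u φ : ℂ → ℂ} (hu : LocallyIntegrable u) (hφ : ContDiff ℝ ∞ φ)
    (hc : HasCompactSupport φ) (k : ℕ) : pd₁^[k] (conv u φ) = conv u (pd₁^[k] φ) := by
  induction k generalizing φ with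
  | zero => rfl
  | succ k ih =>
    rw [Function.iterate_succ_apply, Function.iterate_succ_apply, ← ih hφ.pd₁ hc.pd₁]
    congr 1 with z
    exact fderiv_conv_apply hu hφ hc z 1

theorem dbar_conv {u φ : ℂ → ℂ} (hu : LocallyIntegrable u) (hφ : ContDiff ℝ ∞ φ)
    (hc : HasCompactSupport φ) : dbar (conv u φ) = conv u (dbar φ) := by
  ext z
  have h₁ : pd₁ (conv u φ) z = conv u (pd₁ φ) z := fderiv_conv_apply hu hφ hc z 1
  have h₂ : pd₂ (conv u φ) z = conv u (pd₂ φ) z := fderiv_conv_apply hu hφ hc z Complex.I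
  rw [dbar, h₁, h₂]
  simp only [conv]
  rw [← integral_const_mul, ← integral_add
    (integrable_conv hu hφ.pd₁.continuous hc.pd₁ z)
    ((integrable_conv hu hφ.pd₂.continuous hc.pd₂ z).const_mul _), ← integral_const_mul]
  congr 1 with y
  simp only [dbar]
  ring

theorem continuous_mul_kernel {K φ : ℂ → ℂ} (hK : ContinuousOn K {0}ᶜ) (hφ : Continuous φ)
    {z : ℂ} (hz : z ∉ tsupport φ) : Continuous fun w => K (z - w) * φ w := by
  refine continuous_of_tsupport fun w hw => ?_
  have hw' : w ∈ tsupport φ := tsupport_mul_subset_right hw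
  have hne : z - w ∈ ({0}ᶜ : Set ℂ) := fun h => hz (by rwa [sub_eq_zero.1 h])
  exact ((hK.continuousAt (isOpen_compl_singleton.mem_nhds hne)).comp (f := fun w => z - w)
    (by fun_prop)).mul hφ.continuousAt

/-- For `z'` in a small closed ball around `z` and `w` in the support, `z' - w` stays in a compact
set avoiding the pole, which gives a dominating bound for differentiation under the integral. -/
theorem hasDerivAt_conv_off_tsupport {K φ : ℂ → ℂ} (hK : DifferentiableOn ℂ K {0}ᶜ)
    (hφ : Continuous φ) (hc : HasCompactSupport φ) {z : ℂ} (hz : z ∉ tsupport φ) :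
    HasDerivAt (conv K φ) (conv (deriv K) φ z) z := by
  have hopen : IsOpen ({0}ᶜ : Set ℂ) := isOpen_compl_singleton
  have hdK := hK.deriv hopen
  obtain ⟨ε, hε, hεs⟩ := Metric.nhds_basis_closedBall.mem_iff.1
    ((isClosed_tsupport φ).isOpen_compl.mem_nhds hz)
  have hne : ∀ z' ∈ Metric.closedBall z ε, ∀ w ∈ tsupport φ, z' - w ∈ ({0}ᶜ : Set ℂ) :=
    fun z' hz' w hw h => hεs hz' (by rwa [sub_eq_zero.1 h])
  obtain ⟨M, hM⟩ : ∃ M, ∀ z' ∈ Metric.closedBall z ε, ∀ w ∈ tsupport φ,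
      ‖deriv K (z' - w)‖ ≤ M := by
    have hcpt : IsCompact (Metric.closedBall z ε ×ˢ tsupport φ) :=
      (isCompact_closedBall z ε).prod hc
    obtain ⟨M, hM⟩ := hcpt.exists_bound_of_continuousOn (f := fun p : ℂ × ℂ => deriv K (p.1 - p.2))
      (hdK.continuousOn.comp (by fun_prop) fun p hp => hne p.1 hp.1 p.2 hp.2)
    exact ⟨M, fun z' hz' w hw => hM (z', w) ⟨hz', hw⟩⟩
  have hcs (L : ℂ → ℂ) : HasCompactSupport fun w => L (z - w) * φ w := hc.mul_left
  refine (hasDerivAt_integral_of_dominated_loc_of_deriv_le (Metric.ball_mem_nhds z hε)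
    (F := fun z w => K (z - w) * φ w) (F' := fun z w => deriv K (z - w) * φ w)
    (bound := fun w => M * ‖φ w‖) ?_ ?_ ?_ ?_ ?_ ?_).2
  · filter_upwards [Metric.ball_mem_nhds z hε] with z' hz'
    exact (continuous_mul_kernel hK.continuousOn hφ
      (hεs (Metric.ball_subset_closedBall hz'))).aestronglyMeasurable
  · exact (continuous_mul_kernel hK.continuousOn hφ hz).integrable_of_hasCompactSupport (hcs K)
  · exact (continuous_mul_kernel hdK.continuousOn hφ hz).aestronglyMeasurable
  · refine Eventually.of_forall fun w z' hz' => ?_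
    by_cases hw : w ∈ tsupport φ
    · rw [norm_mul]
      gcongr
      exact hM z' (Metric.ball_subset_closedBall hz') w hw
    · simp [image_eq_zero_of_notMem_tsupport hw]
  · exact (hφ.norm.integrable_of_hasCompactSupport hc.norm).const_mul M
  · refine Eventually.of_forall fun w z' hz' => ?_
    by_cases hw : w ∈ tsupport φ
    · have hd := (hK.differentiableAt (hopen.mem_nhds
        (hne z' (Metric.ball_subset_closedBall hz') w hw))).hasDerivAt
      exact (hd.comp_sub_const z' w).mul_const (φ w)
    · simpa [image_eq_zero_of_notMem_tsupport hw] using hasDerivAt_const z' (0 : ℂ)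

theorem differentiableOn_conv {K φ : ℂ → ℂ} (hK : DifferentiableOn ℂ K {0}ᶜ)
    (hφ : Continuous φ) (hc : HasCompactSupport φ) :
    DifferentiableOn ℂ (conv K φ) (tsupport φ)ᶜ := fun _ hz =>
  (hasDerivAt_conv_off_tsupport hK hφ hc hz).differentiableAt.differentiableWithinAt

theorem iteratedDeriv_conv {K φ : ℂ → ℂ} (hK : DifferentiableOn ℂ K {0}ᶜ)
    (hφ : Continuous φ) (hc : HasCompactSupport φ) (k : ℕ) :
    EqOn (iteratedDeriv k (conv K φ)) (conv (iteratedDeriv k K) φ) (tsupport φ)ᶜ := by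
  induction k with
  | zero => intro z _; simp
  | succ k ih =>
    intro z hz
    rw [iteratedDeriv_succ, iteratedDeriv_succ,
      (ih.eventuallyEq_of_mem ((isClosed_tsupport φ).isOpen_compl.mem_nhds hz)).deriv_eq]
    exact (hasDerivAt_conv_off_tsupport (hK.iteratedDeriv isOpen_compl_singleton k) hφ hc hz).deriv

/-! ### Cut-off functions with uniform bounds -/

/-- Mollify the indicator of `A` at scale `δ`. All derivatives fall on the mollifier, so their
bounds are `L¹`-norms that do not depend on `A`. -/
theorem exists_cutoff {δ : ℝ} (hδ : 0 < δ) (m : ℕ) :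
    ∃ C : ℝ, 0 ≤ C ∧ ∀ A : Set ℂ, MeasurableSet A → ∃ u : ℂ → ℂ, ContDiff ℝ ∞ u ∧
      (∀ k ≤ m, ∀ z, ‖pd₁^[k] u z‖ ≤ C) ∧ (∀ k ≤ m, ∀ z, ‖pd₁^[k] (dbar u) z‖ ≤ C) ∧
      (∀ z, Metric.ball z δ ⊆ A → u z = 1) ∧ (∀ z, Disjoint (Metric.ball z δ) A → u z = 0) := by
  let b : ContDiffBump (0 : ℂ) := ⟨δ / 2, δ, by positivity, by linarith⟩
  set ρ : ℂ → ℂ := fun z => (b.normed volume z : ℂ) with hρ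
  have hρs : ContDiff ℝ ∞ ρ := Complex.ofRealCLM.contDiff.comp b.contDiff_normed
  have hρc : HasCompactSupport ρ :=
    b.hasCompactSupport_normed.comp_left (g := fun x : ℝ => (x : ℂ)) (by simp)
  have hρ0 : ∀ y, y ∉ Metric.ball (0 : ℂ) δ → ρ y = 0 := fun y hy => by
    have : y ∉ Function.support (b.normed volume) := by rwa [b.support_normed_eq]
    simpa [hρ] using this
  have hρi : ∫ y, ρ y = 1 := by
    rw [hρ, integral_complex_ofReal, b.integral_normed]
    simp
  have hds := hρs.dbar
  have hdc := hρc.dbar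
  have hterm (k : ℕ) : 0 ≤ (∫ y, ‖pd₁^[k] ρ y‖) + ∫ y, ‖pd₁^[k] (dbar ρ) y‖ :=
    add_nonneg (integral_nonneg fun _ => norm_nonneg _) (integral_nonneg fun _ => norm_nonneg _)
  refine ⟨∑ k ∈ Finset.range (m + 1), ((∫ y, ‖pd₁^[k] ρ y‖) + ∫ y, ‖pd₁^[k] (dbar ρ) y‖),
    Finset.sum_nonneg fun k _ => hterm k, fun A hA => ?_⟩
  have hle (k : ℕ) (hk : k ≤ m) :=
    Finset.single_le_sum (f := fun k => (∫ y, ‖pd₁^[k] ρ y‖) + ∫ y, ‖pd₁^[k] (dbar ρ) y‖)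
      (fun k _ => hterm k) (Finset.mem_range.2 (Nat.lt_succ_of_le hk))
  set a : ℂ → ℂ := A.indicator fun _ => 1 with ha
  have hal : LocallyIntegrable a :=
    (locallyIntegrable_const (1 : ℂ)).indicator hA
  have ha1 (y : ℂ) : ‖a y‖ ≤ 1 := by
    by_cases hy : y ∈ A <;> simp [ha, hy]
  have hbound {φ : ℂ → ℂ} (hφ : ContDiff ℝ ∞ φ) (hc : HasCompactSupport φ) (k : ℕ) (z : ℂ) :
      ‖pd₁^[k] (conv a φ) z‖ ≤ ∫ y, ‖pd₁^[k] φ y‖ := by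
    rw [pd₁_iterate_conv hal hφ hc]
    refine norm_integral_le_of_norm_le ?_ (Eventually.of_forall fun y => ?_)
    · exact ((hφ.pd₁_iterate k).continuous.integrable_of_hasCompactSupport
        (hc.of_isClosed_subset (isClosed_tsupport _) (tsupport_pd₁_iterate_subset φ k))).norm
    · rw [norm_mul]
      exact mul_le_of_le_one_left (norm_nonneg _) (ha1 _)
  have hball {z y : ℂ} (hy : y ∈ Metric.ball (0 : ℂ) δ) : z - y ∈ Metric.ball z δ := by
    simpa [dist_eq_norm] using hy
  refine ⟨conv a ρ, contDiff_conv hal hρs hρc, fun k hk z => ?_, fun k hk z => ?_, fun z hz => ?_,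
    fun z hz => ?_⟩
  · exact (hbound hρs hρc k z).trans
      ((le_add_of_nonneg_right (integral_nonneg fun _ => norm_nonneg _)).trans (hle k hk))
  · rw [dbar_conv hal hρs hρc]
    exact (hbound hds hdc k z).trans
      ((le_add_of_nonneg_left (integral_nonneg fun _ => norm_nonneg _)).trans (hle k hk))
  · rw [← hρi]
    refine integral_congr_ae (Eventually.of_forall fun y => ?_)
    by_cases hy : y ∈ Metric.ball (0 : ℂ) δ
    · simp [ha, hz (hball hy)]
    · simp [hρ0 y hy]
  · refine integral_eq_zero_of_ae (Eventually.of_forall fun y => ?_)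
    by_cases hy : y ∈ Metric.ball (0 : ℂ) δ
    · simp [ha, fun h => Set.disjoint_left.1 hz (hball hy) h]
    · simp [hρ0 y hy]

/-! ### Holomorphic functions with values in a space of bounded functions -/

/-- The Schwarz lemma, applied to each coordinate on one common disc, gives a Lipschitz estimate at
the centre uniform in `i`. -/
theorem continuousOn_lp_of_apply {ι : Type*} {U : Set ℂ} (hU : IsOpen U)
    {F : ℂ → lp (fun _ : ι => ℂ) ∞} (hF : ∀ i, DifferentiableOn ℂ (fun w => F w i) U)
    (hb : ∀ w ∈ U, ∃ ε > 0, ∃ M, ∀ w' ∈ Metric.ball w ε, ‖F w'‖ ≤ M) : ContinuousOn F U := by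
  intro w hw
  obtain ⟨ε₁, hε₁, M, hM⟩ := hb w hw
  obtain ⟨ε₂, hε₂, hε₂U⟩ := Metric.isOpen_iff.1 hU w hw
  set ε := min ε₁ ε₂
  have hε : 0 < ε := lt_min hε₁ hε₂
  have hM0 : 0 ≤ M := (norm_nonneg _).trans (hM w (Metric.mem_ball_self hε₁))
  refine ContinuousAt.continuousWithinAt ?_
  have hest : ∀ w' ∈ Metric.ball w ε, ‖F w' - F w‖ ≤ 2 * M / ε * dist w' w := by
    intro w' hw'
    refine lp.norm_le_of_forall_le (by positivity) fun i => ?_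
    have hFn {v : ℂ} (hv : v ∈ Metric.ball w ε) : ‖F v i‖ ≤ M :=
      (lp.norm_apply_le_norm (by simp) _ i).trans
        (hM v (Metric.ball_subset_ball (min_le_left _ _) hv))
    have h := Complex.dist_le_div_mul_dist_of_mapsTo_ball (f := fun w => F w i) (c := w) (R₁ := ε)
      (R₂ := 2 * M)
      ((hF i).mono ((Metric.ball_subset_ball (min_le_right _ _)).trans hε₂U)) ?_ hw'
    · simpa [dist_eq_norm] using h
    · intro v hv
      have h₁ := hFn hv
      have h₂ := hFn (Metric.mem_ball_self hε)
      have h₃ := norm_sub_le (F v i) (F w i)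
      refine Metric.mem_closedBall.2 ?_
      rw [dist_eq_norm]
      linarith
  rw [ContinuousAt, tendsto_iff_norm_sub_tendsto_zero]
  refine squeeze_zero' (Eventually.of_forall fun _ => norm_nonneg _)
    (by filter_upwards [Metric.ball_mem_nhds w hε] with w' hw' using hest w' hw') ?_
  have : Tendsto (fun w' => 2 * M / ε * dist w' w) (𝓝 w) (𝓝 (2 * M / ε * dist w w)) :=
    Continuous.tendsto (by fun_prop) w
  simpa using this

/-- A locally bounded map into `ℓ^∞` with holomorphic coordinates is holomorphic. -/
theorem analyticOnNhd_lp_of_apply {ι : Type*} {U : Set ℂ} (hU : IsOpen U)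
    {F : ℂ → lp (fun _ : ι => ℂ) ∞} (hF : ∀ i, DifferentiableOn ℂ (fun w => F w i) U)
    (hb : ∀ w ∈ U, ∃ ε > 0, ∃ M, ∀ w' ∈ Metric.ball w ε, ‖F w'‖ ≤ M) :
    AnalyticOnNhd ℂ F U := by
  have hcont := continuousOn_lp_of_apply hU hF hb
  intro w hw
  obtain ⟨r, hr, hrU⟩ := Metric.nhds_basis_closedBall.mem_iff.1 (hU.mem_nhds hw)
  lift r to NNReal using hr.le
  have hsph : ContinuousOn F (Metric.sphere w r) :=
    hcont.mono (Metric.sphere_subset_closedBall.trans hrU)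
  -- The vector-valued Cauchy integral is analytic because `F` is continuous on the circle; it
  -- equals `F` coordinate by coordinate, by the scalar Cauchy formula.
  have hps := hasFPowerSeriesOn_cauchy_integral (hsph.circleIntegrable r.2) hr
  refine hps.analyticAt.congr ?_
  filter_upwards [Metric.ball_mem_nhds w (show (0 : ℝ) < r from hr)] with v hv
  ext i
  have hint : IntervalIntegrable (fun θ : ℝ => deriv (circleMap w r) θ •
      ((circleMap w r θ - v)⁻¹ • F (circleMap w r θ))) volume 0 (2 * Real.pi) := by
    have : CircleIntegrable (fun z => (z - v)⁻¹ • F z) w r := by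
      refine ContinuousOn.circleIntegrable r.2 (ContinuousOn.fun_smul ?_ hsph)
      refine (continuousOn_id.sub continuousOn_const).inv₀ fun z hz h => ?_
      obtain rfl := sub_eq_zero.1 h
      exact (ne_of_lt hv) hz
    exact this.out
  have hcoord : (∮ z in C(w, r), (z - v)⁻¹ • F z) i = ∮ z in C(w, r), (z - v)⁻¹ • F z i := by
    have h := (lp.evalCLM ℂ (fun _ : ι => ℂ) ∞ i).intervalIntegral_comp_comm hint
    rw [circleIntegral, circleIntegral]
    exact h.symm
  have hC := ((hF i).mono hrU).circleIntegral_sub_inv_smul hv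
  change (2 * Real.pi * Complex.I : ℂ)⁻¹ • (∮ z in C(w, r), (z - v)⁻¹ • F z) i = F v i
  rw [hcoord, hC, inv_smul_smul₀ Complex.two_pi_I_ne_zero]

/-! ### Estimates for the Cauchy kernel -/

theorem differentiableOn_cauchyKernel {g : ℂ → ℂ} (hg : Differentiable ℂ g) :
    DifferentiableOn ℂ (cauchyKernel g) {0}ᶜ := fun z hz => by
  have hpi : (Real.pi : ℂ) ≠ 0 := by exact_mod_cast Real.pi_ne_zero
  have hz' : (Real.pi : ℂ) * z ≠ 0 := mul_ne_zero hpi hz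
  exact ((hg z).div (by fun_prop) hz').differentiableWithinAt

theorem measurable_cauchyKernel {g : ℂ → ℂ} (hg : Differentiable ℂ g) :
    Measurable (cauchyKernel g) :=
  hg.continuous.measurable.div (by fun_prop)

theorem norm_cauchyKernel_le (g : ℂ → ℂ) (z : ℂ) : ‖cauchyKernel g z‖ ≤ ‖g z‖ / ‖z‖ := by
  rw [cauchyKernel, norm_div, norm_mul, Complex.norm_real, Real.norm_eq_abs, abs_of_pos Real.pi_pos]
  rcases eq_or_ne z 0 with rfl | hz
  · simp
  · have : 0 < ‖z‖ := norm_pos_iff.2 hz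
    gcongr
    nlinarith [Real.pi_gt_three]

/-- Cauchy's estimates on a disc that misses the pole. The number `a` will be the weight at a fixed
point, hence constant along the circle. -/
theorem norm_iteratedDeriv_mul_le {K : ℂ → ℂ} (hK : DifferentiableOn ℂ K {0}ᶜ) {c : ℂ} {r M a : ℝ}
    (hr : 0 < r) (hrc : r < ‖c‖) (ha : 0 < a) (hM : ∀ ζ, ‖ζ - c‖ = r → ‖K ζ‖ * a ≤ M) (k : ℕ) :
    ‖iteratedDeriv k K c‖ * a ≤ k.factorial * M / r ^ k := by
  have hsub : Metric.closedBall c r ⊆ {0}ᶜ := fun z hz h => by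
    rw [mem_singleton_iff.1 h, Metric.mem_closedBall, dist_zero_left] at hz
    linarith
  have h := Complex.norm_iteratedDeriv_le_of_forall_mem_sphere_norm_le k hr
    ((hK.mono (Metric.closure_ball_subset_closedBall.trans hsub)).diffContOnCl)
    (C := M / a) fun z hz => (le_div_iff₀ ha).2 (hM z (by simpa [dist_eq_norm] using hz))
  calc ‖iteratedDeriv k K c‖ * a ≤ (k.factorial * (M / a) / r ^ k) * a := by gcongr
    _ = k.factorial * M / r ^ k := by field_simp

theorem setDist_le_edist {A B : Set ℂ} {x y : ℂ} (hx : x ∈ A) (hy : y ∈ B) :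
    setDist A B ≤ edist x y :=
  (iInf₂_le x hx).trans (iInf₂_le y hy)

theorem lt_dist_of_lt_setDist {A B : Set ℂ} {x y : ℂ} (hx : x ∈ A) (hy : y ∈ B) {r : ℝ}
    (h : ENNReal.ofReal r < setDist A B) : r < dist x y := by
  have := h.trans_le (setDist_le_edist hx hy)
  rw [edist_dist] at this
  by_contra hle
  exact absurd (ENNReal.ofReal_le_ofReal (not_lt.1 hle)) (not_le.2 this)

/-! ### Weighted bounds for the kernels of the density condition. -/

namespace DenseCondition

variable {S : WeightSystem} (C : DenseCondition S)

/-- The Cauchy kernel of the entire function `g_n`. -/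
noncomputable def kernel (n : ℕ) : ℂ → ℂ := cauchyKernel (C.g n)

theorem differentiableOn_kernel (n : ℕ) : DifferentiableOn ℂ (C.kernel n) {0}ᶜ :=
  differentiableOn_cauchyKernel (C.entire_g n)

theorem lintegral_kernel_le (n : ℕ) {K : Set ℂ} (hK : IsCompact K) : ∃ A : ℝ, 0 ≤ A ∧
    ∀ x ∈ S.dom n,
      ENNReal.ofReal (S.ν n x) * ∫⁻ y in K, ‖C.kernel n (x - y)‖ₑ ≤ ENNReal.ofReal A := by
  obtain ⟨A, hA, h⟩ := C.integral_compact n K hK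
  refine ⟨A, hA.le, fun x hx => le_trans ?_ (h x hx)⟩
  rw [← lintegral_const_mul' _ _ ENNReal.ofReal_ne_top]
  refine lintegral_mono fun y => ?_
  have hν := S.ν_nonneg n (S.dom_subset_Om n hx)
  rw [← ofReal_norm, ← ENNReal.ofReal_mul hν]
  refine ENNReal.ofReal_le_ofReal ?_
  calc S.ν n x * ‖C.kernel n (x - y)‖ ≤ S.ν n x * (‖C.g n (x - y)‖ / ‖x - y‖) := by
        gcongr
        exact norm_cauchyKernel_le _ _
    _ = ‖C.g n (x - y)‖ * S.ν n x / ‖x - y‖ := by ring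

/-- A single point `x` of `Ω_n` suffices: a)(iii) for the reflected compact set `x - K`, together
with `ν_n(x) > 0`. -/
theorem locallyIntegrable_kernel (n : ℕ) : LocallyIntegrable (C.kernel n) := by
  rw [locallyIntegrable_iff]
  intro K hK
  obtain ⟨x, hx⟩ := S.nonempty_dom n
  obtain ⟨A, -, hA⟩ := C.lintegral_kernel_le n
    (hK.image (f := fun t => x - t) (by fun_prop))
  refine ⟨(measurable_cauchyKernel (C.entire_g n)).aestronglyMeasurable, ?_⟩
  have hν : ENNReal.ofReal (S.ν n x) ≠ 0 := by
    simpa using S.ν_pos n x (S.dom_subset_Om n hx)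
  have h : ∫⁻ y in (fun t => x - t) '' K, ‖C.kernel n (x - y)‖ₑ =
      ∫⁻ t in K, ‖C.kernel n t‖ₑ := by
    rw [← lintegral_indicator hK.measurableSet, ← lintegral_indicator
      (hK.image (f := fun t => x - t) (by fun_prop)).measurableSet,
      ← lintegral_sub_left_eq_self _ x]
    congr 1 with t
    have : x - t ∈ (fun t => x - t) '' K ↔ t ∈ K :=
      ⟨fun ⟨s, hs, h⟩ => sub_right_injective h ▸ hs, fun h => ⟨t, h, rfl⟩⟩
    by_cases ht : t ∈ K <;> simp [indicator, this, ht]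
  rw [hasFiniteIntegral_iff_enorm, ← h]
  by_contra hn
  have := hA x hx
  rw [not_lt_top_iff.1 hn, ENNReal.mul_top hν] at this
  exact ENNReal.ofReal_ne_top (top_le_iff.1 this)

/-- The poles here are arbitrary points off the closure, not just points of `X`. The `L¹`-bound
a)(iii) becomes a pointwise bound because the kernel is holomorphic in the pole, and Cauchy's
estimates then give the derivatives. -/
theorem exists_kernel_bound {n N : ℕ} (hnN : n ≤ N) (m : ℕ) {w : ℂ}
    (hw : w ∈ (closure (S.dom n))ᶜ) :
    ∃ ε > 0, ∃ M : ℝ, ∀ w' ∈ Metric.ball w ε, ∀ k ≤ m, ∀ z ∈ S.dom n,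
      ‖iteratedDeriv k (C.kernel N) (z - w')‖ * S.ν n z ≤ M := by
  obtain ⟨η, hη, hηs⟩ := Metric.isOpen_iff.1 isClosed_closure.isOpen_compl w hw
  -- One `δ` each for moving the pole, for the Cauchy circle and for the `L¹`-disc; the resulting
  -- `3δ` stays below the distance `4δ` to `Ω_n`.
  obtain ⟨δ, hδ, hδη⟩ : ∃ δ > 0, η = 4 * δ := ⟨η / 4, by positivity, by ring⟩
  have hfar : ∀ z ∈ S.dom n, 4 * δ ≤ dist z w := fun z hz => by
    by_contra hlt
    exact hηs (Metric.mem_ball.2 (hδη ▸ not_le.1 hlt)) (subset_closure hz)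
  obtain ⟨B, hB, hBs⟩ := exists_enorm_le_lintegral_ball hδ
  obtain ⟨A, hA, hAs⟩ := C.lintegral_kernel_le N (isCompact_closedBall w (3 * δ))
  have h₀ : ∀ v ∈ Metric.ball w (2 * δ), ∀ z ∈ S.dom n, ‖C.kernel N (z - v)‖ * S.ν n z ≤ B * A := by
    intro v hv z hz
    have hzO := S.dom_subset_Om n hz
    have hd : DifferentiableOn ℂ (fun y => C.kernel N (z - y)) (Metric.ball v δ) := by
      refine (C.differentiableOn_kernel N).comp (by fun_prop) fun y hy h => ?_
      obtain rfl := sub_eq_zero.1 h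
      have := dist_triangle z v w
      have := hfar z hz
      rw [Metric.mem_ball] at hv hy
      linarith
    have h₁ := hBs _ v hd
    have h₂ : ∫⁻ y in Metric.ball v δ, ‖C.kernel N (z - y)‖ₑ ≤
        ∫⁻ y in Metric.closedBall w (3 * δ), ‖C.kernel N (z - y)‖ₑ := by
      refine lintegral_mono_set fun y hy => ?_
      have := dist_triangle y v w
      rw [Metric.mem_ball] at hv hy
      rw [Metric.mem_closedBall]
      linarith
    rw [← ENNReal.ofReal_le_ofReal_iff (by positivity), mul_comm,
      ENNReal.ofReal_mul (S.ν_nonneg n hzO), ofReal_norm, ENNReal.ofReal_mul hB]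
    calc ENNReal.ofReal (S.ν n z) * ‖C.kernel N (z - v)‖ₑ
        ≤ ENNReal.ofReal (S.ν N z) * (ENNReal.ofReal B *
          ∫⁻ y in Metric.closedBall w (3 * δ), ‖C.kernel N (z - y)‖ₑ) := by
          gcongr
          · exact S.ν_mono hnN hzO
          · exact h₁.trans (by gcongr)
      _ = ENNReal.ofReal B * (ENNReal.ofReal (S.ν N z) *
          ∫⁻ y in Metric.closedBall w (3 * δ), ‖C.kernel N (z - y)‖ₑ) := by ring
      _ ≤ ENNReal.ofReal B * ENNReal.ofReal A := by
          gcongr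
          exact hAs z (S.dom_mono hnN hz)
  refine ⟨δ, hδ, ∑ k ∈ Finset.range (m + 1), k.factorial * (B * A) / δ ^ k,
    fun w' hw' k hk z hz => ?_⟩
  refine (norm_iteratedDeriv_mul_le (C.differentiableOn_kernel N) hδ ?_
    (S.ν_pos n z (S.dom_subset_Om n hz)) (fun ζ hζ => ?_) k).trans
    (Finset.single_le_sum (f := fun k : ℕ => k.factorial * (B * A) / δ ^ k)
      (fun k _ => by positivity) (Finset.mem_range.2 (Nat.lt_succ_of_le hk)))
  · rw [← dist_eq_norm]
    have := dist_triangle z w' w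
    have := hfar z hz
    rw [Metric.mem_ball] at hw'
    linarith
  -- Moving the argument `ζ` of the kernel amounts to moving the pole to `z - ζ`, so the weight
  -- stays at the same `z`.
  · have := h₀ (z - ζ) ?_ z hz
    · rwa [sub_sub_cancel] at this
    · have h₁ := dist_triangle (z - ζ) w' w
      have h₂ : dist (z - ζ) w' = δ := by
        rw [dist_eq_norm, ← hζ, ← norm_neg]
        congr 1
        ring
      rw [Metric.mem_ball] at hw' ⊢
      linarith

theorem differentiableOn_kernel_sub (n : ℕ) (w : ℂ) :
    DifferentiableOn ℂ (fun z => C.kernel n (z - w)) {w}ᶜ :=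
  (C.differentiableOn_kernel n).comp (by fun_prop) fun _ hz h => hz (sub_eq_zero.1 h)

theorem iteratedDeriv_kernel_sub (n : ℕ) (w : ℂ) (k : ℕ) :
    iteratedDeriv k (fun z => C.kernel n (z - w)) =
      fun z => iteratedDeriv k (C.kernel n) (z - w) := iteratedDeriv_comp_sub_const k _ w

/-- Cauchy's estimates on the circle of radius `r` from a)(ii): since `|z - w| > r + R`, it keeps
distance `R` from the pole, so dividing by `ζ` costs at most `1/R`. -/
theorem kernel_mem_dbarSpace (n : ℕ) {w : ℂ} (hw : w ∈ C.X n) :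
    (fun z : S.dom (C.I₂ n) => C.kernel n (z - w)) ∈ S.dbarSpace (C.I₂ n) := by
  rw [S.mem_dbarSpace_iff]
  have he := eqOn_zeroExt (U := S.dom (C.I₂ n)) fun z => C.kernel n (z - w)
  have hsub : S.dom (C.I₂ n) ⊆ {w}ᶜ := fun z hz h =>
    C.X_subset n hw (subset_closure (mem_singleton_iff.1 h ▸ hz))
  refine ⟨((C.differentiableOn_kernel_sub n w).mono hsub).congr he, fun k => ?_⟩
  obtain ⟨R, r, A, hR, -, hRr, hd, -, -, hA⟩ := C.cauchy_bound n
  refine ⟨k.factorial * (A w / R) / r ^ k, fun z hz => ?_⟩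
  rw [he.iteratedDeriv (S.isOpen_dom _) k hz, iteratedDeriv_kernel_sub]
  have hdist : r + R < ‖z - w‖ := by
    rw [← dist_eq_norm, dist_comm]
    exact lt_dist_of_lt_setDist hw hz hd
  refine norm_iteratedDeriv_mul_le (C.differentiableOn_kernel n) (hR.trans hRr) (by linarith)
    (S.ν_pos _ z (S.dom_subset_Om _ hz)) (fun ζ hζ => ?_) k
  have hζR : R ≤ ‖ζ‖ := by
    have := norm_sub_norm_le (z - w) ζ
    rw [norm_sub_rev (z - w) ζ] at this
    linarith
  have hAw := hA z hz w ⟨w, hw, 0, Metric.mem_ball_self hR, add_zero w⟩ ζ hζ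
  have hν := S.ν_nonneg (C.I₂ n) (S.dom_subset_Om _ hz)
  calc ‖C.kernel n ζ‖ * S.ν (C.I₂ n) z ≤ ‖C.g n ζ‖ / ‖ζ‖ * S.ν (C.I₂ n) z := by
        gcongr
        exact norm_cauchyKernel_le _ _
    _ = ‖C.g n ζ‖ * S.ν (C.I₂ n) z / ‖ζ‖ := by ring
    _ ≤ A w / ‖ζ‖ := by gcongr
    _ ≤ A w / R := by
        have : 0 ≤ A w := le_trans (by positivity) hAw
        gcongr

end DenseCondition

/-! ### Density of the kernels -/

theorem zeroExt_add {U : Set ℂ} (f g : U → ℂ) : zeroExt (f + g) = zeroExt f + zeroExt g := by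
  ext z
  by_cases hz : z ∈ U
  · simp [zeroExt_of_mem _ hz]
  · have h : ¬∃ x : U, (x : ℂ) = z := fun ⟨x, hx⟩ => hz (hx ▸ x.2)
    simp [zeroExt, Function.extend_apply' _ _ _ h]

theorem zeroExt_smul {U : Set ℂ} (c : ℂ) (f : U → ℂ) : zeroExt (c • f) = c • zeroExt f := by
  ext z
  by_cases hz : z ∈ U
  · simp [zeroExt_of_mem _ hz]
  · have h : ¬∃ x : U, (x : ℂ) = z := fun ⟨x, hx⟩ => hz (hx ▸ x.2)
    simp [zeroExt, Function.extend_apply' _ _ _ h]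

theorem _root_.DifferentiableOn.contDiffAt_complex {U : Set ℂ} (hU : IsOpen U) {f : ℂ → ℂ}
    (hf : DifferentiableOn ℂ f U) {z : ℂ} (hz : z ∈ U) {k : WithTop ℕ∞} : ContDiffAt ℂ k f z :=
  (hf.contDiffOn hU).contDiffAt (hU.mem_nhds hz)

/-! ### Weighted jets as vectors in `ℓ^∞`. -/

namespace WeightSystem

variable (S : WeightSystem)

theorem add_mem_dbarSpace {n : ℕ} {f g : S.dom n → ℂ} (hf : f ∈ S.dbarSpace n)
    (hg : g ∈ S.dbarSpace n) : f + g ∈ S.dbarSpace n := by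
  rw [mem_dbarSpace_iff] at *
  rw [zeroExt_add]
  refine ⟨hf.1.add hg.1, fun k => ?_⟩
  obtain ⟨A, hA⟩ := hf.2 k
  obtain ⟨B, hB⟩ := hg.2 k
  refine ⟨A + B, fun x hx => ?_⟩
  rw [iteratedDeriv_add (hf.1.contDiffAt_complex (S.isOpen_dom n) hx)
    (hg.1.contDiffAt_complex (S.isOpen_dom n) hx)]
  have := S.ν_nonneg n (S.dom_subset_Om n hx)
  calc _ ≤ (‖iteratedDeriv k (zeroExt f) x‖ + ‖iteratedDeriv k (zeroExt g) x‖) * S.ν n x := by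
        gcongr
        exact norm_add_le _ _
    _ ≤ A + B := by
        rw [add_mul]
        exact add_le_add (hA x hx) (hB x hx)

theorem smul_mem_dbarSpace {n : ℕ} (c : ℂ) {f : S.dom n → ℂ} (hf : f ∈ S.dbarSpace n) :
    c • f ∈ S.dbarSpace n := by
  rw [mem_dbarSpace_iff] at *
  rw [zeroExt_smul]
  refine ⟨hf.1.const_smul c, fun k => ?_⟩
  obtain ⟨A, hA⟩ := hf.2 k
  refine ⟨‖c‖ * A, fun x hx => ?_⟩
  rw [iteratedDeriv_const_smul_field, norm_smul, mul_assoc]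
  gcongr
  exact hA x hx

/-- The weighted derivatives up to order `m` of a function on `Ω_n`. -/
noncomputable def jet (n m : ℕ) (h : ℂ → ℂ) (i : S.dom n × Fin (m + 1)) : ℂ :=
  S.ν n i.1 * iteratedDeriv i.2 h i.1

theorem norm_jet (n m : ℕ) (h : ℂ → ℂ) (i : S.dom n × Fin (m + 1)) :
    ‖S.jet n m h i‖ = ‖iteratedDeriv i.2 h i.1‖ * S.ν n i.1 := by
  rw [jet, norm_mul, Complex.norm_real, Real.norm_eq_abs,
    abs_of_nonneg (S.ν_nonneg n (S.dom_subset_Om n i.1.2)), mul_comm]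

/-- The jets on `Ω_n` of the elements of `ℰν_k,∂̄(Ω_k)`, as a subspace of `ℓ^∞`. -/
def jetSpace (k n m : ℕ) (hkn : n ≤ k) :
    Submodule ℂ (lp (fun _ : S.dom n × Fin (m + 1) => ℂ) ∞) where
  carrier := {v | ∃ h ∈ S.dbarSpace k, ∀ i, v i = S.jet n m (zeroExt h) i}
  add_mem' := by
    rintro v w ⟨f, hf, hv⟩ ⟨g, hg, hw⟩
    refine ⟨f + g, S.add_mem_dbarSpace hf hg, fun i => ?_⟩
    have hi := S.dom_mono hkn i.1.2
    rw [zeroExt_add, jet, iteratedDeriv_add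
      (((S.mem_dbarSpace_iff.1 hf).1).contDiffAt_complex (S.isOpen_dom k) hi)
      (((S.mem_dbarSpace_iff.1 hg).1).contDiffAt_complex (S.isOpen_dom k) hi), mul_add]
    exact congrArg₂ (· + ·) (hv i) (hw i)
  zero_mem' := by
    have h0 : zeroExt (0 : S.dom k → ℂ) = 0 := by
      simpa using zeroExt_smul (0 : ℂ) (0 : S.dom k → ℂ)
    refine ⟨0, ?_, fun i => ?_⟩
    · rw [mem_dbarSpace_iff, h0]
      exact ⟨differentiableOn_const 0, fun k => ⟨0, fun x _ => by simp⟩⟩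
    · rw [h0]
      simp [jet]
  smul_mem' := by
    rintro c v ⟨f, hf, hv⟩
    refine ⟨c • f, S.smul_mem_dbarSpace c hf, fun i => ?_⟩
    rw [zeroExt_smul, jet, iteratedDeriv_const_smul_field, smul_eq_mul, mul_left_comm]
    exact congrArg (c * ·) (hv i)

end WeightSystem

/-! ### Pole pushing. -/

namespace DenseCondition

variable {S : WeightSystem} (C : DenseCondition S)

open scoped Classical in
/-- The jet on `Ω_n` of the kernel with pole `w`, as an element of `ℓ^∞`. -/
noncomputable def kernelJet (N n m : ℕ) (w : ℂ) : lp (fun _ : S.dom n × Fin (m + 1) => ℂ) ∞ :=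
  -- The default value `0` is harmless: for `n ≤ N` the jet is bounded whenever `w` lies off the
  -- closure of `Ω_n`, and only such poles matter.
  if h : Memℓp (S.jet n m fun z => C.kernel N (z - w)) ∞ then
    ⟨S.jet n m fun z => C.kernel N (z - w), h⟩ else 0

theorem exists_jet_kernel_bound {n N : ℕ} (hnN : n ≤ N) (m : ℕ) {w : ℂ}
    (hw : w ∈ (closure (S.dom n))ᶜ) :
    ∃ ε > 0, ∃ M : ℝ, ∀ w' ∈ Metric.ball w ε, ∀ i,
      ‖S.jet n m (fun z => C.kernel N (z - w')) i‖ ≤ M := by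
  obtain ⟨ε, hε, M, hM⟩ := C.exists_kernel_bound hnN m hw
  refine ⟨ε, hε, M, fun w' hw' i => ?_⟩
  rw [S.norm_jet, iteratedDeriv_kernel_sub]
  exact hM w' hw' _ (Nat.lt_succ_iff.1 i.2.2) _ i.1.2

theorem kernelJet_apply {n N : ℕ} (hnN : n ≤ N) (m : ℕ) {w : ℂ}
    (hw : w ∈ (closure (S.dom n))ᶜ) (i : S.dom n × Fin (m + 1)) :
    C.kernelJet N n m w i = S.ν n i.1 * iteratedDeriv i.2 (C.kernel N) (i.1 - w) := by
  have h : Memℓp (S.jet n m fun z => C.kernel N (z - w)) ∞ := by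
    obtain ⟨ε, hε, M, hM⟩ := C.exists_jet_kernel_bound hnN m hw
    refine memℓp_infty ⟨M, ?_⟩
    rintro _ ⟨i, rfl⟩
    exact hM w (Metric.mem_ball_self hε) i
  rw [kernelJet, dif_pos h]
  change S.jet n m (fun z => C.kernel N (z - w)) i = _
  rw [WeightSystem.jet, iteratedDeriv_kernel_sub]

theorem analyticOnNhd_kernelJet {n N : ℕ} (hnN : n ≤ N) (m : ℕ) :
    AnalyticOnNhd ℂ (C.kernelJet N n m) (closure (S.dom n))ᶜ := by
  have hopen : IsOpen (closure (S.dom n))ᶜ := isClosed_closure.isOpen_compl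
  refine analyticOnNhd_lp_of_apply hopen (fun i => ?_) fun w hw => ?_
  · refine DifferentiableOn.congr ?_ fun w hw => C.kernelJet_apply hnN m hw i
    refine DifferentiableOn.const_mul ?_ _
    refine ((C.differentiableOn_kernel N).iteratedDeriv isOpen_compl_singleton _).comp
      (by fun_prop) fun w hw h => hw ?_
    rw [← sub_eq_zero.1 h]
    exact subset_closure i.1.2
  · obtain ⟨ε, hε, M, hM⟩ := C.exists_jet_kernel_bound hnN m hw
    obtain ⟨η, hη, hηs⟩ := Metric.isOpen_iff.1 hopen w hw
    refine ⟨min ε η, lt_min hε hη, max M 0, fun w' hw' => ?_⟩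
    refine lp.norm_le_of_forall_le (le_max_right _ _) fun i => ?_
    rw [C.kernelJet_apply hnN m (hηs (Metric.ball_subset_ball (min_le_right _ _) hw'))]
    have := hM w' (Metric.ball_subset_ball (min_le_left _ _) hw') i
    rw [WeightSystem.jet, iteratedDeriv_kernel_sub] at this
    exact this.trans (le_max_left _ _)

theorem closure_dom_mono {n k : ℕ} (h : n ≤ k) : closure (S.dom n) ⊆ closure (S.dom k) :=
  closure_mono (S.dom_mono h)

theorem kernelJet_mem_jetSpace (n m : ℕ) {w : ℂ} (hw : w ∈ C.X (C.I₁₄ n)) :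
    C.kernelJet (C.I₁₄ n) n m w ∈ S.jetSpace (C.I₂₁₄ n) n m (C.le_I₂₁₄ n) := by
  refine ⟨fun z : S.dom (C.I₂₁₄ n) => C.kernel (C.I₁₄ n) (z - w),
    C.kernel_mem_dbarSpace (C.I₁₄ n) hw, fun i => ?_⟩
  have hw' : w ∈ (closure (S.dom n))ᶜ := fun h =>
    C.X_subset _ hw (closure_dom_mono (C.le_I₂₁₄ n) h)
  rw [C.kernelJet_apply (C.le_I₁₄ n) m hw', WeightSystem.jet,
    (eqOn_zeroExt fun z => C.kernel (C.I₁₄ n) (z - w)).iteratedDeriv (S.isOpen_dom _) _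
      (S.dom_mono (C.le_I₂₁₄ n) i.1.2), iteratedDeriv_kernel_sub]

/-- Modulo the closed subspace `H`, the jet is a holomorphic function of the pole that vanishes on
the open set `X`. By c) with `M` the closure of `Ω_n`, the component of `w` meets `X`, so the
identity theorem applies. The quotient map takes the place of the functionals in a Hahn-Banach
argument. -/
theorem kernelJet_mem_closure (n m : ℕ) {w : ℂ} (hw : w ∈ (closure (S.dom n))ᶜ) :
    C.kernelJet (C.I₁₄ n) n m w ∈
      (S.jetSpace (C.I₂₁₄ n) n m (C.le_I₂₁₄ n)).topologicalClosure := by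
  set H := (S.jetSpace (C.I₂₁₄ n) n m (C.le_I₂₁₄ n)).topologicalClosure with hH
  have : IsClosed (H : Set (lp (fun _ : S.dom n × Fin (m + 1) => ℂ) ∞)) :=
    Submodule.isClosed_topologicalClosure _
  set U : Set ℂ := connectedComponentIn (closure (S.dom n))ᶜ w
  have hUsub : U ⊆ (closure (S.dom n))ᶜ := connectedComponentIn_subset _ _
  obtain ⟨x, hxU, hxX⟩ := C.component_meets n _ isClosed_closure Subset.rfl w hw
    ⟨w, mem_connectedComponentIn hw, hw⟩
  have han : AnalyticOnNhd ℂ (fun w => H.mkQL (C.kernelJet (C.I₁₄ n) n m w)) U := fun v hv =>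
    (H.mkQL.analyticAt _).comp (C.analyticOnNhd_kernelJet (C.le_I₁₄ n) m v (hUsub hv))
  have hz := han.eqOn_zero_of_preconnected_of_eventuallyEq_zero isPreconnected_connectedComponentIn
    hxU (by
      filter_upwards [(C.isOpen_X _).mem_nhds hxX] with v hv
      simpa using Submodule.le_topologicalClosure _ (C.kernelJet_mem_jetSpace n m hv))
  simpa using hz (mem_connectedComponentIn hw)

/-- Convolutions of the kernel with functions supported off `closure Ω_n` are approximated on `Ω_n`
by elements of `ℰν_k,∂̄(Ω_k)`, `k = I₂₁₄(n)`. -/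
theorem exists_approx_conv_kernel (n m : ℕ) {φ : ℂ → ℂ} (hφ : Continuous φ)
    (hc : HasCompactSupport φ) (hs : tsupport φ ⊆ (closure (S.dom n))ᶜ) {ε : ℝ} (hε : 0 < ε) :
    ∃ h ∈ S.dbarSpace (C.I₂₁₄ n), ∀ k ≤ m, ∀ z ∈ S.dom n,
      ‖iteratedDeriv k (conv (C.kernel (C.I₁₄ n)) φ) z - iteratedDeriv k (zeroExt h) z‖ *
        S.ν n z ≤ ε := by
  set e := C.kernelJet (C.I₁₄ n) n m with he
  set H := (S.jetSpace (C.I₂₁₄ n) n m (C.le_I₂₁₄ n)).topologicalClosure with hH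
  have hcont : Continuous fun w => φ w • e w := by
    refine continuous_of_tsupport fun w hw => ?_
    have hw' : w ∈ (closure (S.dom n))ᶜ := hs (tsupport_smul_subset_left φ e hw)
    exact hφ.continuousAt.smul
      (C.analyticOnNhd_kernelJet (C.le_I₁₄ n) m w hw').continuousAt
  have hint : Integrable fun w => φ w • e w :=
    hcont.integrable_of_hasCompactSupport hc.smul_right
  have hmem : ∫ w, φ w • e w ∈ H := by
    have : IsClosed (H : Set (lp (fun _ : S.dom n × Fin (m + 1) => ℂ) ∞)) :=
      Submodule.isClosed_topologicalClosure _
    -- The integrand lies in `H` for every `w`, and the quotient map commutes with the integral.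
    have hq : ∫ w, H.mkQL (φ w • e w) = 0 := by
      refine integral_eq_zero_of_ae (Eventually.of_forall fun w => ?_)
      by_cases hw : w ∈ tsupport φ
      · simpa using Or.inr (C.kernelJet_mem_closure n m (hs hw))
      · simp [image_eq_zero_of_notMem_tsupport hw]
    rw [H.mkQL.integral_comp_comm hint] at hq
    simpa using hq
  -- Evaluation at `i` commutes with the integral, and at points off the support of `φ` the
  -- derivatives of the convolution fall on the kernel.
  have hcoord (i : S.dom n × Fin (m + 1)) : (∫ w, φ w • e w : lp (fun _ => ℂ) ∞) i =
      S.jet n m (conv (C.kernel (C.I₁₄ n)) φ) i := by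
    have h := (lp.evalCLM ℂ (fun _ : S.dom n × Fin (m + 1) => ℂ) ∞ i).integral_comp_comm hint
    have hi : (i.1 : ℂ) ∈ (tsupport φ)ᶜ := fun h => hs h (subset_closure i.1.2)
    refine h.symm.trans ?_
    rw [WeightSystem.jet, iteratedDeriv_conv (C.differentiableOn_kernel _) hφ hc _ hi, conv,
      ← integral_const_mul]
    congr 1 with w
    change φ w * e w i = _
    by_cases hw : w ∈ tsupport φ
    · rw [he, C.kernelJet_apply (C.le_I₁₄ n) m (hs hw)]
      ring
    · simp [image_eq_zero_of_notMem_tsupport hw]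
  obtain ⟨v, ⟨h, hh, hv⟩, hdist⟩ := Metric.mem_closure_iff.1
    (show ∫ w, φ w • e w ∈ closure (S.jetSpace (C.I₂₁₄ n) n m (C.le_I₂₁₄ n) : Set _) from hmem) ε hε
  refine ⟨h, hh, fun k hk z hz => ?_⟩
  let i : S.dom n × Fin (m + 1) := (⟨z, hz⟩, ⟨k, Nat.lt_succ_of_le hk⟩)
  have h₁ := lp.norm_apply_le_norm (by simp) ((∫ w, φ w • e w) - v) i
  have h₂ : ((∫ w, φ w • e w) - v : lp (fun _ => ℂ) ∞) i =
      S.jet n m (conv (C.kernel (C.I₁₄ n)) φ) i - S.jet n m (zeroExt h) i :=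
    congrArg₂ (· - ·) (hcoord i) (hv i)
  have h₃ := h₁.trans ((dist_eq_norm _ v).symm.trans_le hdist.le)
  rw [h₂, WeightSystem.jet, WeightSystem.jet, ← mul_sub, norm_mul, Complex.norm_real,
    Real.norm_eq_abs, abs_of_nonneg (S.ν_nonneg n (S.dom_subset_Om n hz)), mul_comm] at h₃
  exact h₃

end DenseCondition

/-! ### Approximation -/

theorem inter_frontier_nonempty_of_isPreconnected {X : Type*} [TopologicalSpace X] {s u : Set X}
    (hs : IsPreconnected s) (h₁ : (s ∩ u).Nonempty) (h₂ : (s ∩ uᶜ).Nonempty) :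
    (s ∩ frontier u).Nonempty := by
  by_contra hn
  have h (x) (hx : x ∈ s) : x ∈ closure u → x ∈ interior u := fun hc => by
    by_contra hi
    exact hn ⟨x, hx, hc, hi⟩
  obtain ⟨x, hx, hxu⟩ := h₁
  obtain ⟨y, hy, hyu⟩ := h₂
  obtain ⟨z, -, hz₁, hz₂⟩ := hs (interior u) (closure u)ᶜ isOpen_interior isClosed_closure.isOpen_compl
    (fun w hw => or_iff_not_imp_right.2 fun hc => h w hw (not_not.1 hc))
    ⟨x, hx, h x hx (subset_closure hxu)⟩
    ⟨y, hy, fun hc => hyu (interior_subset (h y hy hc))⟩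
  exact hz₂ (interior_subset_closure hz₁)

/-- A ball is connected, so if it left `U` it would meet the frontier at distance less than `η` from
`z`. -/
theorem ball_subset_of_lt_setDist {A U : Set ℂ} (hAU : A ⊆ U) {η : ℝ}
    (h : ENNReal.ofReal η < setDist A (frontier U)) {z : ℂ} (hz : z ∈ A) :
    Metric.ball z η ⊆ U := by
  intro y hy
  by_contra hyU
  have hη : 0 < η := dist_nonneg.trans_lt hy
  obtain ⟨x, hx, hxU⟩ := inter_frontier_nonempty_of_isPreconnected (convex_ball z η).isPreconnected
    ⟨z, Metric.mem_ball_self hη, hAU hz⟩ ⟨y, hy, hyU⟩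
  have := lt_dist_of_lt_setDist hz hxU h
  rw [Metric.mem_ball, dist_comm] at hx
  linarith

theorem tsupport_subset_compl_of_eqOn_zero {f : ℂ → ℂ} {U : Set ℂ} (hU : IsOpen U)
    (h : EqOn f 0 U) : tsupport f ⊆ Uᶜ :=
  closure_minimal (fun _ hz hzU => hz (h hzU)) hU.isClosed_compl

/-- A cut-off function which is `1` near `A` and supported in the open set `U`, all of whose
derivatives up to order `m` are bounded, if `A` has positive distance from the boundary of `U`. -/
theorem exists_cutoff_of_setDist_pos {A U : Set ℂ} (hAU : A ⊆ U)
    (h : 0 < setDist A (frontier U)) (m : ℕ) :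
    ∃ (ψ : ℂ → ℂ) (T : Set ℂ) (B : ℝ), ContDiff ℝ ∞ ψ ∧ 0 ≤ B ∧ (∀ k ≤ m, ∀ z, ‖pd₁^[k] ψ z‖ ≤ B) ∧
      IsOpen T ∧ closure A ⊆ T ∧ EqOn ψ (fun _ => 1) T ∧ tsupport ψ ⊆ U := by
  obtain ⟨η, -, hη, hηd⟩ := ENNReal.lt_iff_exists_real_btwn.1 h
  have hη : 0 < η := ENNReal.ofReal_pos.1 hη
  have hU : Metric.thickening η A ⊆ U := fun y hy => by
    obtain ⟨z, hz, hyz⟩ := Metric.mem_thickening_iff.1 hy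
    exact ball_subset_of_lt_setDist hAU hηd hz hyz
  -- Mollifying the `η/2`-thickening at scale `η/4` gives the value `1` on the `η/4`-thickening and
  -- support within distance `3η/4 < η` of `A`.
  obtain ⟨B, hB, hcut⟩ := exists_cutoff (δ := η / 4) (by positivity) m
  obtain ⟨ψ, hψ, hψB, -, hψ1, hψ0⟩ := hcut (Metric.thickening (η / 2) A)
    Metric.isOpen_thickening.measurableSet
  refine ⟨ψ, Metric.thickening (η / 4) A, B, hψ, hB, hψB, Metric.isOpen_thickening,
    Metric.closure_subset_thickening (by positivity) A, fun z hz => hψ1 z fun y hy => ?_, ?_⟩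
  · obtain ⟨x, hx, hzx⟩ := Metric.mem_thickening_iff.1 hz
    refine Metric.mem_thickening_iff.2 ⟨x, hx, ?_⟩
    have := dist_triangle y z x
    rw [Metric.mem_ball] at hy
    linarith
  · refine (closure_minimal (fun z hz => ?_)
      (Metric.isClosed_cthickening (δ := 3 * η / 4) (E := A))).trans
      ((Metric.cthickening_subset_thickening' hη (by linarith) A).trans hU)
    refine Metric.thickening_subset_cthickening _ _ ?_
    obtain ⟨y, hyz, hy⟩ := Set.not_disjoint_iff.1 fun hd => hz (hψ0 z hd)
    obtain ⟨x, hx, hyx⟩ := Metric.mem_thickening_iff.1 hy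
    refine Metric.mem_thickening_iff.2 ⟨x, hx, ?_⟩
    have := dist_triangle z y x
    rw [Metric.mem_ball, dist_comm] at hyz
    linarith

/-- The order of the quantifiers is the point: `B` does not depend on `R`, so the radius may be
chosen after all constants. -/
theorem exists_ball_cutoff (m : ℕ) : ∃ B : ℝ, 0 ≤ B ∧ ∀ R : ℝ, ∃ χ : ℂ → ℂ,
    ContDiff ℝ ∞ χ ∧ HasCompactSupport χ ∧ (∀ k ≤ m, ∀ z, ‖pd₁^[k] χ z‖ ≤ B) ∧
      (∀ k ≤ m, ∀ z, ‖pd₁^[k] (dbar χ) z‖ ≤ B) ∧ EqOn χ (fun _ => 1) (Metric.ball 0 R) := by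
  obtain ⟨B, hB, hcut⟩ := exists_cutoff one_pos m
  refine ⟨B, hB, fun R => ?_⟩
  obtain ⟨χ, hχ, hχB, hχB', hχ1, hχ0⟩ := hcut (Metric.ball 0 (R + 1)) Metric.isOpen_ball.measurableSet
  refine ⟨χ, hχ, ?_, hχB, hχB', fun z hz => hχ1 z (Metric.ball_subset_ball' ?_)⟩
  · refine HasCompactSupport.of_support_subset_isCompact (isCompact_closedBall (0 : ℂ) (R + 2))
      fun z hz => ?_
    obtain ⟨y, hyz, hy⟩ := Set.not_disjoint_iff.1 fun hd => hz (hχ0 z hd)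
    have := dist_triangle z y 0
    rw [Metric.mem_ball] at hyz hy
    rw [dist_comm] at hyz
    rw [Metric.mem_closedBall]
    linarith
  · rw [Metric.mem_ball] at hz
    linarith

theorem contDiff_mul_of_tsupport_subset {ψ F : ℂ → ℂ} {U : Set ℂ} (hU : IsOpen U)
    (hψ : ContDiff ℝ ∞ ψ) (hF : ContDiffOn ℝ ∞ F U) (hs : tsupport ψ ⊆ U) :
    ContDiff ℝ ∞ (ψ * F) := by
  rw [contDiff_iff_contDiffAt]
  intro z
  by_cases hz : z ∈ U
  · exact hψ.contDiffAt.mul (hF.contDiffAt (hU.mem_nhds hz))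
  · have h0 : ψ =ᶠ[𝓝 z] 0 := notMem_tsupport_iff_eventuallyEq.1 fun h => hz (hs h)
    refine (contDiffAt_const (c := (0 : ℂ))).congr_of_eventuallyEq ?_
    filter_upwards [h0] with y hy
    simp [hy]

theorem pd₁_iterate_zero (k : ℕ) : pd₁^[k] 0 = 0 := by
  induction k with
  | zero => rfl
  | succ k ih =>
    rw [Function.iterate_succ_apply', ih]
    ext z
    simp [pd₁]

theorem pd₁_iterate_eq_zero {f : ℂ → ℂ} {U : Set ℂ} (hU : IsOpen U) (h : EqOn f 0 U) (k : ℕ)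
    {z : ℂ} (hz : z ∈ U) : pd₁^[k] f z = 0 := by
  rw [h.pd₁_iterate hU k hz, pd₁_iterate_zero]
  rfl

/-! ### Error estimates for the cut-off decomposition. -/

namespace DenseCondition

variable {S : WeightSystem} (C : DenseCondition S)

/-- Estimate `|φ|` by `c / ν_{I₄(n)}` under the integral; what is left is b) for the pair `(I₄(n),
n)`. -/
theorem exists_norm_conv_kernel_le (n : ℕ) : ∃ A : ℝ, 0 ≤ A ∧ ∀ (φ : ℂ → ℂ) (c : ℝ), 0 ≤ c →
    (∀ y ∈ S.dom (C.I₄ n), ‖φ y‖ * S.ν (C.I₄ n) y ≤ c) → (∀ y ∉ S.dom (C.I₄ n), φ y = 0) →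
    ∀ x ∈ S.dom n, ‖conv (C.kernel (C.I₁₄ n)) φ x‖ * S.ν n x ≤ A * c := by
  obtain ⟨A, hA, h⟩ := C.integral_dom n
  refine ⟨A, hA.le, fun φ c hc hφ hφ0 x hx => ?_⟩
  have hx' := S.ν_nonneg n (S.dom_subset_Om n hx)
  have hint := h (C.I₄ n, n) (by simp) x hx
  rw [← ENNReal.ofReal_le_ofReal_iff (by positivity), mul_comm, ENNReal.ofReal_mul hx', ofReal_norm,
    mul_comm A, ENNReal.ofReal_mul hc]
  have hpt (y : ℂ) : ENNReal.ofReal (S.ν n x) * ‖C.kernel (C.I₁₄ n) (x - y) * φ y‖ₑ ≤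
      (S.dom (C.I₄ n)).indicator (fun y => ENNReal.ofReal c *
        ENNReal.ofReal (‖C.g (C.I₁₄ n) (x - y)‖ * S.ν n x / (‖x - y‖ * S.ν (C.I₄ n) y))) y := by
    by_cases hy : y ∈ S.dom (C.I₄ n)
    · rw [indicator_of_mem hy, ← ofReal_norm, ← ENNReal.ofReal_mul hx', ← ENNReal.ofReal_mul hc]
      refine ENNReal.ofReal_le_ofReal ?_
      have hν := S.ν_pos (C.I₄ n) y (S.dom_subset_Om _ hy)
      calc S.ν n x * ‖C.kernel (C.I₁₄ n) (x - y) * φ y‖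
          ≤ S.ν n x * (‖C.g (C.I₁₄ n) (x - y)‖ / ‖x - y‖ * (c / S.ν (C.I₄ n) y)) := by
            rw [norm_mul]
            gcongr
            · exact norm_cauchyKernel_le _ _
            · rw [le_div_iff₀ hν]
              exact hφ y hy
        _ = c * (‖C.g (C.I₁₄ n) (x - y)‖ * S.ν n x / (‖x - y‖ * S.ν (C.I₄ n) y)) := by
            simp only [div_eq_mul_inv, mul_inv]
            ring
    · simp [hφ0 y hy]
  calc ENNReal.ofReal (S.ν n x) * ‖conv (C.kernel (C.I₁₄ n)) φ x‖ₑ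
      ≤ ENNReal.ofReal (S.ν n x) * ∫⁻ y, ‖C.kernel (C.I₁₄ n) (x - y) * φ y‖ₑ := by
        gcongr
        exact enorm_integral_le_lintegral_enorm _
    _ = ∫⁻ y, ENNReal.ofReal (S.ν n x) * ‖C.kernel (C.I₁₄ n) (x - y) * φ y‖ₑ :=
        (lintegral_const_mul' _ _ ENNReal.ofReal_ne_top).symm
    _ ≤ _ := lintegral_mono hpt
    _ ≤ _ := by
        rw [lintegral_indicator (S.isOpen_dom _).measurableSet,
          lintegral_const_mul' _ _ ENNReal.ofReal_ne_top]
        gcongr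
        exact hint

/-- Up to a small error, a function in `ℰν_k,∂̄(Ω_k)`, `k = I₁₄(n)`, agrees on `Ω_n` with the
convolution of the kernel and a test function supported off `closure Ω_n`. -/
theorem exists_approx_by_conv_kernel (n m : ℕ) {f : S.dom (C.I₁₄ n) → ℂ}
    (hf : f ∈ S.dbarSpace (C.I₁₄ n)) {ε : ℝ} (hε : 0 < ε) :
    ∃ φ : ℂ → ℂ, Continuous φ ∧ HasCompactSupport φ ∧ tsupport φ ⊆ (closure (S.dom n))ᶜ ∧
      ∀ k ≤ m, ∀ z ∈ S.dom n, ‖iteratedDeriv k (zeroExt f) z -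
        iteratedDeriv k (conv (C.kernel (C.I₁₄ n)) φ) z‖ * S.ν n z ≤ ε := by
  set F := zeroExt f with hF
  set E := C.kernel (C.I₁₄ n) with hE
  set q := C.I₄ n with hq
  set N := C.I₁₄ n with hN
  have hnq : n ≤ q := (C.lt_I₄ n).le
  have hqN : q ≤ N := (C.lt_I₁ q).le
  have hopN := S.isOpen_dom N
  have hopn := S.isOpen_dom n
  obtain ⟨hFd, hFb⟩ := S.mem_dbarSpace_iff.1 hf
  rw [← hF] at hFd hFb
  have hFs : ContDiffOn ℝ ∞ F (S.dom N) := hFd.contDiffOn_real hopN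
  choose M' hM' using hFb
  obtain ⟨M, hM0, hM⟩ : ∃ M : ℝ, 0 ≤ M ∧ ∀ j ≤ m, ∀ y ∈ S.dom N,
      ‖pd₁^[j] F y‖ ≤ M / S.ν N y := by
    refine ⟨∑ j ∈ Finset.range (m + 1), |M' j|, Finset.sum_nonneg fun _ _ => abs_nonneg _,
      fun j hj y hy => ?_⟩
    rw [pd₁_iterate_eq_iteratedDeriv hopN hFd j hy,
      le_div_iff₀ (S.ν_pos N y (S.dom_subset_Om N hy))]
    exact ((hM' j y hy).trans (le_abs_self _)).trans (Finset.single_le_sum (f := fun j => |M' j|)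
      (fun _ _ => abs_nonneg _) (Finset.mem_range.2 (Nat.lt_succ_of_le hj)))
  obtain ⟨ψ, T, P, hψ, hP, hψP, hT, hTn, hψT, hψs⟩ :=
    exists_cutoff_of_setDist_pos (S.dom_mono hnq) (C.setDist_pos n q (C.lt_I₄ n)) m
  obtain ⟨Q, hQ, hcut⟩ := exists_ball_cutoff m
  obtain ⟨A, hA, hconv⟩ := C.exists_norm_conv_kernel_le n
  -- `D / ν_N` will bound the derivatives of `φ₂ = ∂̄χ ψF` (Leibniz twice), and `D' / ν_N` those of
  -- `F - χF`. Neither depends on the radius of `χ`.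
  set D : ℝ := 2 ^ m * (Q * (2 ^ m * (P * M))) with hD
  set D' : ℝ := M + 2 ^ m * (Q * M) with hD'
  have hD0 : 0 ≤ D := by positivity
  have hD'0 : 0 ≤ D' := by positivity
  -- The total error will be `(A D + D') κ`; the summand `1` keeps the denominator positive.
  set κ : ℝ := ε / (A * D + D' + 1) with hκ
  have hκ0 : 0 < κ := by positivity
  obtain ⟨K, hK, -, hKν⟩ := C.small_off_compact q κ hκ0
  change ∀ x ∈ S.dom q \ K, S.ν q x ≤ κ * S.ν N x at hKν
  obtain ⟨R, hR⟩ := hK.isBounded.subset_ball (0 : ℂ)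
  obtain ⟨χ, hχ, hχc, hχQ, hχQ', hχ1⟩ := hcut R
  have hG : ContDiff ℝ ∞ (ψ * F) :=
    contDiff_mul_of_tsupport_subset hopN hψ hFs (hψs.trans (S.dom_mono hqN))
  have hGs : tsupport (ψ * F) ⊆ S.dom q := tsupport_mul_subset_left.trans hψs
  have hTq : T ⊆ S.dom q := fun z hz =>
    hψs (subset_tsupport _ (by rw [Function.mem_support, hψT hz]; exact one_ne_zero))
  have hTN := hTq.trans (S.dom_mono hqN)
  have hGF : EqOn (ψ * F) F T := fun z hz => by simp [hψT hz]
  have hdG : EqOn (dbar (ψ * F)) 0 T := fun z hz => by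
    rw [dbar_congr hT hGF hz]
    exact dbar_eq_zero (hFd.differentiableAt (hopN.mem_nhds (hTN hz)))
  have hdχ : EqOn (dbar χ) 0 (Metric.ball 0 R) := fun z hz => by
    rw [dbar_congr Metric.isOpen_ball hχ1 hz]
    exact dbar_eq_zero (by fun_prop)
  set φ₁ := χ * dbar (ψ * F) with hφ₁
  set φ₂ := dbar χ * (ψ * F) with hφ₂
  have hφ₁s : ContDiff ℝ ∞ φ₁ := hχ.mul hG.dbar
  have hφ₂s : ContDiff ℝ ∞ φ₂ := hχ.dbar.mul hG
  have hφ₁c : HasCompactSupport φ₁ := hχc.mul_right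
  have hφ₂c : HasCompactSupport φ₂ := hχc.dbar.mul_right
  have hφ₁t : tsupport φ₁ ⊆ (closure (S.dom n))ᶜ :=
    tsupport_mul_subset_right.trans ((tsupport_subset_compl_of_eqOn_zero hT hdG).trans
      (compl_subset_compl.2 hTn))
  have hEl : LocallyIntegrable E := C.locallyIntegrable_kernel N
  have hsum (z : ℂ) : conv E φ₁ z + conv E φ₂ z = χ z * (ψ z * F z) := by
    have h := cauchyKernel_conv_dbar (C.entire_g N) (C.g_zero N) (hχ.mul hG) hχc.mul_right z
    refine Eq.trans ?_ h
    rw [conv, conv, ← integral_add (integrable_conv hEl hφ₁s.continuous hφ₁c z)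
      (integrable_conv hEl hφ₂s.continuous hφ₂c z)]
    congr 1 with y
    have hd := dbar_mul (hχ.differentiable (by simp) y) (hG.differentiable (by simp) y)
    change _ = E (z - y) * dbar (χ * (ψ * F)) y
    rw [hd, hφ₁, hφ₂]
    simp only [Pi.mul_apply]
    ring
  refine ⟨φ₁, hφ₁s.continuous, hφ₁c, hφ₁t, fun k hk z hz => ?_⟩
  have hzN := S.dom_mono (hnq.trans hqN) hz
  have hzO := S.dom_subset_Om n hz
  have hcd : DifferentiableOn ℂ (conv E φ₁) (S.dom n) :=
    (differentiableOn_conv (C.differentiableOn_kernel N) hφ₁s.continuous hφ₁c).mono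
      fun y hy h => hφ₁t h (subset_closure hy)
  have hFdn := hFd.mono (S.dom_mono (hnq.trans hqN))
  have hFsn := hFs.mono (S.dom_mono (hnq.trans hqN))
  -- The decomposition `hsum`, read on `Ω_n`, where `ψ = 1`.
  have heq : EqOn (F - conv E φ₁) ((F - χ * F) + conv E φ₂) (S.dom n) := fun y hy => by
    have h := hsum y
    rw [hψT (hTn (subset_closure hy)), one_mul] at h
    simp only [Pi.sub_apply, Pi.add_apply, Pi.mul_apply]
    linear_combination -h
  have hχF : ContDiffOn ℝ ∞ (χ * F) (S.dom n) := hχ.contDiffOn.mul hFsn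
  have hsplit : iteratedDeriv k F z - iteratedDeriv k (conv E φ₁) z =
      pd₁^[k] (F - χ * F) z + conv E (pd₁^[k] φ₂) z := by
    rw [← iteratedDeriv_sub (hFdn.contDiffAt_complex hopn hz) (hcd.contDiffAt_complex hopn hz),
      ← pd₁_iterate_eq_iteratedDeriv hopn (hFdn.sub hcd) k hz, heq.pd₁_iterate hopn k hz,
      pd₁_iterate_add hopn k (f := F - χ * F) (hFsn.sub hχF) (contDiff_conv hEl hφ₂s hφ₂c).contDiffOn hz,
      Pi.add_apply, pd₁_iterate_conv hEl hφ₂s hφ₂c]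
  -- On `K` the function vanishes, as `χ = 1` on a ball containing `K`; off `K` one has `ν_n ≤ ν_q ≤
  -- κ ν_N`. The same dichotomy handles `φ₂` below.
  have hbound₁ : ‖pd₁^[k] (F - χ * F) z‖ * S.ν n z ≤ D' * κ := by
    by_cases hzK : z ∈ K
    · have h0 : EqOn (F - χ * F) 0 (Metric.ball 0 R) := fun y hy => by simp [hχ1 hy]
      rw [pd₁_iterate_eq_zero Metric.isOpen_ball h0 k (hR hzK), norm_zero, zero_mul]
      positivity
    · have hν : 0 < S.ν N z := S.ν_pos N z (S.dom_subset_Om N hzN)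
      have h₁ : ‖pd₁^[k] (F - χ * F) z‖ ≤ D' / S.ν N z := by
        rw [pd₁_iterate_sub hopn k hFsn hχF hz, hD', add_div]
        refine (norm_sub_le _ _).trans (add_le_add (hM k hk z hzN) ?_)
        have := norm_pd₁_iterate_mul_le hopn hz k hχ.contDiffOn hFsn
          (fun j hj => hχQ j (hj.trans hk) z) (fun j hj => hM j (hj.trans hk) z hzN)
        refine this.trans ?_
        rw [mul_div_assoc, mul_div_assoc]
        gcongr
        exact one_le_two
      calc _ ≤ D' / S.ν N z * (κ * S.ν N z) := by
            gcongr
            · exact S.ν_nonneg n hzO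
            · exact (S.ν_mono hnq hzO).trans (hKν z ⟨S.dom_mono hnq hz, hzK⟩)
        _ = D' * κ := by field_simp
  have hbound₂ : ‖conv E (pd₁^[k] φ₂) z‖ * S.ν n z ≤ A * (D * κ) := by
    refine hconv _ _ (by positivity) (fun y hy => ?_) (fun y hy => ?_) z hz
    · by_cases hyK : y ∈ K
      · have h0 : EqOn φ₂ 0 (Metric.ball 0 R) := fun y hy => by simp [hφ₂, hdχ hy]
        rw [pd₁_iterate_eq_zero Metric.isOpen_ball h0 k (hR hyK), norm_zero, zero_mul]
        positivity
      · have hyN := S.dom_mono hqN hy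
        have hν : 0 < S.ν N y := S.ν_pos N y (S.dom_subset_Om N hyN)
        have h₁ (j : ℕ) (hj : j ≤ m) : ‖pd₁^[j] (ψ * F) y‖ ≤ 2 ^ m * (P * (M / S.ν N y)) := by
          refine (norm_pd₁_iterate_mul_le hopN hyN j hψ.contDiffOn hFs
            (fun i hi => hψP i (hi.trans hj) y) (fun i hi => hM i (hi.trans hj) y hyN)).trans ?_
          gcongr
          exact one_le_two
        have h₂ : ‖pd₁^[k] φ₂ y‖ ≤ D / S.ν N y := by
          refine (norm_pd₁_iterate_mul_le isOpen_univ (mem_univ y) k hχ.dbar.contDiffOn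
            hG.contDiffOn (fun i hi => hχQ' i (hi.trans hk) y)
            (fun i hi => h₁ i (hi.trans hk))).trans ?_
          rw [hD]
          simp only [mul_div_assoc]
          gcongr
          exact one_le_two
        calc _ ≤ D / S.ν N y * (κ * S.ν N y) := by
              gcongr
              · exact S.ν_nonneg q (S.dom_subset_Om q hy)
              · exact hKν y ⟨hy, hyK⟩
          _ = D * κ := by field_simp
    · exact image_eq_zero_of_notMem_tsupport fun h => hy
        (hGs (tsupport_mul_subset_right (tsupport_pd₁_iterate_subset _ _ h)))
  rw [hsplit]
  calc _ ≤ (‖pd₁^[k] (F - χ * F) z‖ + ‖conv E (pd₁^[k] φ₂) z‖) * S.ν n z := by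
        gcongr
        · exact S.ν_nonneg n hzO
        · exact norm_add_le _ _
    _ ≤ D' * κ + A * (D * κ) := by
        rw [add_mul]
        exact add_le_add hbound₁ hbound₂
    _ = (A * D + D') * κ := by ring
    _ ≤ (A * D + D' + 1) * κ := mul_le_mul_of_nonneg_right (by linarith) hκ0.le
    _ = ε := by rw [hκ]; field_simp

theorem exists_approx (n m : ℕ) {f : S.dom (C.I₁₄ n) → ℂ}
    (hf : f ∈ S.dbarSpace (C.I₁₄ n)) {ε : ℝ} (hε : 0 < ε) :
    ∃ h ∈ S.dbarSpace (C.I₂₁₄ n), ∀ k ≤ m, ∀ z ∈ S.dom n,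
      ‖iteratedDeriv k (zeroExt f) z - iteratedDeriv k (zeroExt h) z‖ * S.ν n z ≤ ε := by
  obtain ⟨φ, hφ, hc, hs, h₁⟩ := C.exists_approx_by_conv_kernel n m hf (half_pos hε)
  obtain ⟨h, hh, h₂⟩ := C.exists_approx_conv_kernel n m hφ hc hs (half_pos hε)
  refine ⟨h, hh, fun k hk z hz => ?_⟩
  have hν := S.ν_nonneg n (S.dom_subset_Om n hz)
  calc _ ≤ (‖iteratedDeriv k (zeroExt f) z - iteratedDeriv k (conv (C.kernel (C.I₁₄ n)) φ) z‖ +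
        ‖iteratedDeriv k (conv (C.kernel (C.I₁₄ n)) φ) z - iteratedDeriv k (zeroExt h) z‖) *
          S.ν n z := by
        gcongr
        exact norm_sub_le_norm_sub_add_norm_sub _ _ _
    _ ≤ ε / 2 + ε / 2 := by
        rw [add_mul]
        exact add_le_add (h₁ k hk z hz) (h₂ k hk z hz)
    _ = ε := add_halves ε

end DenseCondition

end WeightedCR

/-! ### The density theorem. -/

theorem mainTheorem3 (S : WeightedCR.WeightSystem) (C : WeightedCR.DenseCondition S) (n : ℕ) :
    WeightedCR.IsDenseIn (S.seminorm n)
      (S.res (C.le_I₂₁₄ n) '' S.dbarSpace (C.I₂₁₄ n))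
      (S.res (C.le_I₁₄ n) '' S.dbarSpace (C.I₁₄ n)) := by
  refine ⟨?_, ?_⟩
  · rintro _ ⟨h, hh, rfl⟩
    exact ⟨S.res (C.lt_I₂ (C.I₁₄ n)).le h, S.res_mem_dbarSpace _ hh, rfl⟩
  · rintro _ ⟨f, hf, rfl⟩ s ε hε
    -- The largest order in `s` controls all the seminorms; `ε / 2` leaves room for strict
    -- inequality after taking suprema.
    obtain ⟨h, hh, hfh⟩ := C.exists_approx n (s.sup id) hf (half_pos hε)
    refine ⟨_, ⟨h, hh, rfl⟩, fun m hm => lt_of_le_of_lt ?_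
      ((ENNReal.ofReal_lt_ofReal_iff hε).2 (half_lt_self hε))⟩
    have hop := S.isOpen_dom n
    have hfd := (S.mem_dbarSpace_iff.1 hf).1.mono (S.dom_mono (C.le_I₁₄ n))
    have hhd := (S.mem_dbarSpace_iff.1 hh).1.mono (S.dom_mono (C.le_I₂₁₄ n))
    have he : EqOn (WeightedCR.zeroExt (S.res (C.le_I₁₄ n) f - S.res (C.le_I₂₁₄ n) h))
        (WeightedCR.zeroExt f - WeightedCR.zeroExt h) (S.dom n) := fun x hx => by
      rw [WeightedCR.zeroExt_of_mem _ hx, Pi.sub_apply, Pi.sub_apply,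
        ← S.eqOn_zeroExt_res (C.le_I₁₄ n) f hx, ← S.eqOn_zeroExt_res (C.le_I₂₁₄ n) h hx,
        WeightedCR.zeroExt_of_mem _ hx, WeightedCR.zeroExt_of_mem _ hx]
    refine S.seminorm_le ((hfd.sub hhd).congr he) fun k hk x hx => ?_
    rw [he.iteratedDeriv hop k hx, iteratedDeriv_sub (hfd.contDiffAt_complex hop hx)
      (hhd.contDiffAt_complex hop hx)]
    exact hfh k (hk.trans (Finset.le_sup (f := id) hm)) x hx
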